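/- Let $\mathfrak l$ be a real Lie algebra isomorphic to $\mathfrak{su}(2)$ or $\mathfrak{sl}(2,\mathbb R)$, let $\theta_{\mathfrak l}$ be an automorphism of $\mathfrak l$ with $\theta_{\mathfrak l}^2=\mathrm{id}$, and let $\mathfrak a$ be an orthogonal $(\mathfrak l,\theta_{\mathfrak l})$-module: a finite-dimensional real representation $\rho$ of $\mathfrak l$ with a non-degenerate, possibly indefinite, $\mathfrak l$-invariant symmetric bilinear form $\langle\cdot,\cdot\rangle$ and an isometry $\theta_{\mathfrak a}$ with $\theta_{\mathfrak a}^2=\mathrm{id}$ and $\theta_{\mathfrak a}\circ\rho(\theta_{\mathfrak l}L)=\rho(L)\circ\theta_{\mathfrak a}$. Assume that $\mathfrak a$ is semi-simple as an $\mathfrak l$-module. Subscripts $\pm$ denote $\pm1$-eigenspaces of the involutions. Definitions (for any finite-dimensional real $\mathfrak l$ with involution and any such $\mathfrak a$). Let $C^p(\mathfrak l,\mathfrak a)$ and $C^p(\mathfrak l)$ be the alternating $p$-linear maps from $\mathfrak l$ to $\mathfrak a$ and $\mathbb R$, $d$ the Chevalley–Eilenberg differential, $\langle\cdot\wedge\cdot\rangle$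 the wedge product (sum over shuffles) composed with the form, and $\Theta$ the involution $\alpha\mapsto\theta_{\mathfrak a}\circ\theta_{\mathfrak l}^*\alpha$ on $C^p(\mathfrak l,\mathfrak a)$ and $\gamma\mapsto\theta_{\mathfrak l}^*\gamma$ on $C^p(\mathfrak l)$. Then $\mathcal H^2_Q(\mathfrak l,\theta_{\mathfrak l},\mathfrak a)$ is the set of pairs $(\alpha,\gamma)\in C^2(\mathfrak l,\mathfrak a)\oplus C^3(\mathfrak l)$ that are $\Theta$-invariant with $d\alpha=0$, $d\gamma=\frac12\langle\alpha\wedge\alpha\rangle$, modulo $$(\alpha,\gamma)\sim\big(\alpha+d\tau,\ \gamma+d\sigma+\langle(\alpha+\tfrac12d\tau)\wedge\tau\rangle\big),\qquad \tau\in C^1(\mathfrak l,\mathfrak a)_+,\ \sigma\in C^2(\mathfrak l)_+ .$$ Let $R_0(\mathfrak l)=\mathfrak l$, let $R_{k+1}(\mathfrak l)$ be the smallest ideal in $R_k(\mathfrak l)$ with $R_k(\mathfrak l)/R_{k+1}(\mathfrak l)$ a semi-simple $\mathfrak l$-module, and let $S(\mathfrak l)$ be the largest ideal that is semi-simple as an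 $\mathfrak l$-module. For semi-simple $\mathfrak a$, let $\alpha_0$ be the $\mathfrak a^{\mathfrak l}$-component of $\alpha$ with respect to $\mathfrak a=\mathfrak a^{\mathfrak l}\oplus\rho(\mathfrak l)\mathfrak a$, and for a subspace $V\subset\mathfrak l$ write $\ker[\cdot,\cdot]_V$ for the kernel of the bracket $\bigwedge^2V\to\mathfrak l$. A class $[\alpha,\gamma]$ is *admissible* (belongs to $\mathcal H^2_Q(\mathfrak l,\theta_{\mathfrak l},\mathfrak a)_\sharp$) if it has a representative $(\alpha,\gamma)$ such that: - $(T_2)$ $\mathfrak a^{\mathfrak l}_+=\alpha_0(\ker[\cdot,\cdot]_{\mathfrak l_-})$. - $(A_0)$ If $L_0\in\mathfrak z(\mathfrak l)\cap\ker\rho$ and there are $A_0\in\mathfrak a$, $Z_0\in\mathfrak l^*$ with $\alpha(L,L_0)=\rho(L)A_0$ and $\gamma(L,L_0,\cdot)=-\langle A_0,\alpha(L,\cdot)\rangle+Z_0([L,\cdot])$ for all $L\in\mathfrak l$, then $L_0=0$. - $(B_0)$ $\alpha_0(\ker[\cdot,\cdot]_{\mathfrak l})\subset\mathfrak a^{\mathfrak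 l}$ is non-degenerate. - $(A_k)$, $k\ge1$: If $\mathfrak k\subset S(\mathfrak l)\cap R_k(\mathfrak l)$ is an ideal of $\mathfrak l$ and there are $\Phi_1\in\mathrm{Hom}(\mathfrak k,\mathfrak a)$, $\Phi_2\in\mathrm{Hom}(\mathfrak k,R_k(\mathfrak l)^*)$ with $\alpha(L,K)=\rho(L)\Phi_1(K)-\Phi_1([L,K])$ and $\gamma(L,K,\cdot)=-\langle\Phi_1(K),\alpha(L,\cdot)\rangle+\langle\Phi_2(K),[L,\cdot]\rangle+\langle\Phi_2([L,K]),\cdot\rangle$ in $R_k(\mathfrak l)^*$ for all $L\in\mathfrak l$, $K\in\mathfrak k$, then $\mathfrak k=0$. - $(B_k)$, $k\ge1$: The greatest submodule $\mathfrak b_k\subset\mathfrak a$ for which some $\Phi\in\mathrm{Hom}(R_k(\mathfrak l),\mathfrak a)$ satisfies $\langle\alpha(L,K),B\rangle=\langle\rho(L)\Phi(K)-\Phi([L,K]),B\rangle$ for all $L\in\mathfrak l$, $K\in R_k(\mathfrak l)$, $B\in\mathfrak b_k$ is non-degenerate. A morphism of triples $(\mathfrak l,\theta_{\mathfrak l},\mathfrak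 a)\to(\mathfrak l_1,\theta_{\mathfrak l_1},\mathfrak a_1)$ is a pair of a Lie algebra homomorphism $q:\mathfrak l\to\mathfrak l_1$ and an isometric embedding $j:\mathfrak a_1\to\mathfrak a$, both commuting with the involutions, with $j\circ\rho_1(q(L))=\rho(L)\circ j$; it acts by $(q,j)^*(\alpha,\gamma)=(j\circ q^*\alpha,q^*\gamma)$, and it is zero if $q=0$ and $j=0$. A class $\varphi$ is *decomposable* if $\varphi=(q_1,j_1)^*\varphi_1+(q_2,j_2)^*\varphi_2$ (sum formed on representatives) for classes $\varphi_i\in\mathcal H^2_Q(\mathfrak l_i,\theta_{\mathfrak l_i},\mathfrak a_i)$ and non-zero morphisms $(q_i,j_i):(\mathfrak l,\theta_{\mathfrak l},\mathfrak a)\to(\mathfrak l_i,\theta_{\mathfrak l_i},\mathfrak a_i)$ such that $(q_1,q_2):\mathfrak l\to\mathfrak l_1\oplus\mathfrak l_2$ and $j_1+j_2:\mathfrak a_1\oplus\mathfrak a_2\to\mathfrak a$ form an isomorphism of triples. Let $\mathcal H^2_Q(\mathfrak l,\theta_{\mathfrak l},\mathfrak a)_0$ be the set of admissible classes that are not decomposable.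 Claim. 1. If $\theta_{\mathfrak l}\ne\mathrm{id}$, then $[\mathfrak l_-,\mathfrak l_-]=\mathfrak l_+$ (the standing condition $(T_1)$ under which admissible classes are of interest). 2. For every $\gamma\in C^3(\mathfrak l)$ the pair $(0,\gamma)$ is a $\Theta$-invariant quadratic cocycle, and $\gamma\mapsto[0,\gamma]$ is a bijection $C^3(\mathfrak l)\to\mathcal H^2_Q(\mathfrak l,\theta_{\mathfrak l},\mathfrak a)$. 3. If $\mathfrak a^{\mathfrak l}=0$, then $\mathcal H^2_Q(\mathfrak l,\theta_{\mathfrak l},\mathfrak a)_0=\mathcal H^2_Q(\mathfrak l,\theta_{\mathfrak l},\mathfrak a)$, that is, all of $C^3(\mathfrak l)$ under this bijection. 4. If $\mathfrak a^{\mathfrak l}\ne0$, then $\mathcal H^2_Q(\mathfrak l,\theta_{\mathfrak l},\mathfrak a)_0=\emptyset$. -/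

import Mathlib

universe u v

noncomputable section

namespace QuadCoh


section Algebras

attribute [local instance 100] LieRing.ofAssociativeRing

/-- The real Lie algebra `su(2)` of trace-free skew-Hermitian complex `2 × 2` matrices. -/
def su2 : LieSubalgebra ℝ (Matrix (Fin 2) (Fin 2) ℂ) where
  carrier := {X | X.conjTranspose = -X ∧ X.trace = 0}
  add_mem' := by
    rintro a b ⟨ha, ha'⟩ ⟨hb, hb'⟩
    exact ⟨by rw [Matrix.conjTranspose_add, ha, hb]; abel, by rw [Matrix.trace_add, ha', hb', add_zero]⟩
  zero_mem' := ⟨by simp, by simp⟩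
  smul_mem' := by
    rintro c a ⟨ha, ha'⟩
    exact ⟨by rw [Matrix.conjTranspose_smul, ha]; simp, by rw [Matrix.trace_smul, ha', smul_zero]⟩
  lie_mem' := by
    rintro a b ⟨ha, -⟩ ⟨hb, -⟩
    refine ⟨?_, ?_⟩
    · rw [Ring.lie_def, Matrix.conjTranspose_sub, Matrix.conjTranspose_mul,
        Matrix.conjTranspose_mul, ha, hb]
      simp
    · rw [Ring.lie_def, Matrix.trace_sub, Matrix.trace_mul_comm, sub_self]

/-- The real Lie algebra `L` is (isomorphic to) `su(2)` or `sl(2, ℝ)`. -/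
def IsSu2OrSl2 (L : Type*) [LieRing L] [LieAlgebra ℝ L] : Prop :=
  Nonempty (L ≃ₗ⁅ℝ⁆ su2) ∨ Nonempty (L ≃ₗ⁅ℝ⁆ LieAlgebra.SpecialLinear.sl (Fin 2) ℝ)

end Algebras

/-- A module over a Lie algebra is semi-simple if every submodule has a complementary submodule. -/
def IsSemisimpleLie (L : Type*) (M : Type*) [LieRing L] [LieAlgebra ℝ L] [AddCommGroup M]
    [Module ℝ M] [LieRingModule L M] [LieModule ℝ L M] : Prop :=
  ComplementedLattice (LieSubmodule ℝ L M)

section Ideals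

variable (L : Type*) [LieRing L] [LieAlgebra ℝ L]

/-- The chain of ideals `R_0(L) = L ⊇ R_1(L) ⊇ R_2(L) ⊇ ...`: here `R_{k+1}(L)` is the smallest
ideal contained in `R_k(L)` such that the `L`-module `R_k(L) / R_{k+1}(L)` is semi-simple. -/
def radSeries : ℕ → LieIdeal ℝ L
  | 0 => ⊤
  | k + 1 => sInf {I : LieIdeal ℝ L | I ≤ radSeries k ∧
      IsSemisimpleLie L (↥(radSeries k) ⧸ LieSubmodule.comap (LieSubmodule.incl (radSeries k)) I)}

/-- The ideal `S(L) = S_1(L)`: the largest ideal of `L` that is semi-simple as an `L`-module. -/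
def socleIdeal : LieIdeal ℝ L :=
  sSup {I : LieIdeal ℝ L | IsSemisimpleLie L ↥I}

end Ideals

section Cochains

open LieModule.Cohomology

variable {L : Type*} [LieRing L] [LieAlgebra ℝ L] {M : Type*} [AddCommGroup M] [Module ℝ M]

/-- A 2-cochain (an alternating bilinear map) viewed as an alternating map on `Fin 2`-families. -/
def toAlt (c : twoCochain ℝ L M) : L [⋀^Fin 2]→ₗ[ℝ] M where
  toFun w := c (w 0) (w 1)
  map_update_add' := by
    intro _ w i x y
    fin_cases i <;> simp [Function.update]
  map_update_smul' := by
    intro _ w i r x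
    fin_cases i <;> simp [Function.update]
  map_eq_zero_of_eq' := by
    intro w i j h hij
    fin_cases i <;> fin_cases j <;> simp_all

variable (L) in
/-- The Lie bracket as an alternating bilinear map. -/
def bracketCochain : twoCochain ℝ L L :=
  ⟨LinearMap.mk₂ ℝ (fun x y => ⁅x, y⁆) add_lie smul_lie lie_add (fun c x y => lie_smul c x y),
    fun x => by simp⟩

/-- The subspace `α(ker [·,·]_V)` of `M`, for a subspace `V` of `L`. Here `[·,·]_V` is the linear
map `⋀² V → L` induced by the bracket, and `α` is regarded as a linear map `⋀² V → M`. -/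
def imageKerBracket (c : twoCochain ℝ L M) (V : Submodule ℝ L) : Submodule ℝ M :=
  Submodule.map
    (exteriorPower.alternatingMapLinearEquiv ((toAlt c).compLinearMap V.subtype))
    (LinearMap.ker
      (exteriorPower.alternatingMapLinearEquiv
        ((toAlt (bracketCochain L)).compLinearMap V.subtype)))

/-- Pull-back `U ∘ S^* c` of a 2-cochain. -/
def pull2 {L' : Type*} [LieRing L'] [LieAlgebra ℝ L'] {M' : Type*} [AddCommGroup M'] [Module ℝ M']
    (S : L →ₗ⁅ℝ⁆ L') (U : M' →ₗ[ℝ] M) (c : twoCochain ℝ L' M') : twoCochain ℝ L M :=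
  ⟨(LinearMap.compl₁₂ c.val (S : L →ₗ[ℝ] L') (S : L →ₗ[ℝ] L')).compr₂ U, fun x => by simp⟩

/-- Pull-back `S^* g` of a real-valued 3-cochain. -/
def pull3 {L' : Type*} [LieRing L'] [LieAlgebra ℝ L'] (S : L →ₗ⁅ℝ⁆ L')
    (g : L' [⋀^Fin 3]→ₗ[ℝ] ℝ) : L [⋀^Fin 3]→ₗ[ℝ] ℝ :=
  g.compLinearMap (S : L →ₗ[ℝ] L')

/-- The Chevalley-Eilenberg differential of a real-valued 2-cochain (trivial coefficients). -/
def dReal2 (s : twoCochain ℝ L ℝ) (x y z : L) : ℝ :=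
  - s ⁅x, y⁆ z + s ⁅x, z⁆ y - s ⁅y, z⁆ x

/-- The Chevalley-Eilenberg differential of a real-valued 3-cochain (trivial coefficients). -/
def dReal3 (g : L [⋀^Fin 3]→ₗ[ℝ] ℝ) (x y z w : L) : ℝ :=
  - g ![⁅x, y⁆, z, w] + g ![⁅x, z⁆, y, w] - g ![⁅x, w⁆, y, z]
    - g ![⁅y, z⁆, x, w] + g ![⁅y, w⁆, x, z] - g ![⁅z, w⁆, x, y]

/-- The product `⟨a ∧ t⟩ ∈ C³(L)` of `a ∈ C²(L, M)` and `t ∈ C¹(L, M)`. -/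
def wedge21 (B : LinearMap.BilinForm ℝ M) (a : twoCochain ℝ L M) (t : L →ₗ[ℝ] M) (x y z : L) : ℝ :=
  B (a x y) (t z) - B (a x z) (t y) + B (a y z) (t x)

/-- The product `⟨a ∧ b⟩ ∈ C⁴(L)` of `a, b ∈ C²(L, M)`. -/
def wedge22 (B : LinearMap.BilinForm ℝ M) (a b : twoCochain ℝ L M) (x y z w : L) : ℝ :=
  B (a x y) (b z w) - B (a x z) (b y w) + B (a x w) (b y z)
    + B (a y z) (b x w) - B (a y w) (b x z) + B (a z w) (b x y)

end Cochains

/-- A triple `(𝔩, θ_𝔩, 𝔞)`: a finite-dimensional real Lie algebra `L` with an involutive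
automorphism `thL`, and an orthogonal `(L, thL)`-module `A`, i.e. a finite-dimensional real
`L`-module with a (possibly indefinite) non-degenerate symmetric `L`-invariant bilinear form and an
involutive isometry `thA` compatible with `thL`. -/
structure Triple : Type (max (u + 1) (v + 1)) where
  L : Type u
  A : Type v
  [lieRing : LieRing L]
  [lieAlgebra : LieAlgebra ℝ L]
  [finL : FiniteDimensional ℝ L]
  [addCommGroup : AddCommGroup A]
  [module : Module ℝ A]
  [finA : FiniteDimensional ℝ A]
  [lieRingModule : LieRingModule L A]
  [lieModule : LieModule ℝ L A]
  thL : L →ₗ⁅ℝ⁆ L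
  thL_invol : ∀ x, thL (thL x) = x
  form : LinearMap.BilinForm ℝ A
  form_symm : form.IsSymm
  form_nondeg : form.Nondegenerate
  form_inv : ∀ (x : L) (a b : A), form ⁅x, a⁆ b + form a ⁅x, b⁆ = 0
  thA : A →ₗ[ℝ] A
  thA_invol : ∀ a, thA (thA a) = a
  thA_isom : ∀ a b, form (thA a) (thA b) = form a b
  compat : ∀ (x : L) (a : A), thA ⁅thL x, a⁆ = ⁅x, thA a⁆

attribute [instance] Triple.lieRing Triple.lieAlgebra Triple.finL Triple.addCommGroup Triple.module
  Triple.finA Triple.lieRingModule Triple.lieModule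

namespace Triple

open LieModule.Cohomology

/-- `C²(𝔩, 𝔞)`. -/
abbrev C2A (T : Triple.{u, v}) : Type (max u v) := twoCochain ℝ T.L T.A

/-- `C²(𝔩)`. -/
abbrev C2 (T : Triple.{u, v}) : Type u := twoCochain ℝ T.L ℝ

/-- `C³(𝔩)`. -/
abbrev C3 (T : Triple.{u, v}) : Type u := T.L [⋀^Fin 3]→ₗ[ℝ] ℝ

/-- The set `Z²_Q(𝔩, 𝔞)₊` of quadratic 2-cocycles invariant under the involution
`Θ = (θ_𝔩, θ_𝔞)^*`: pairs `(α, γ)` of `Θ`-invariant cochains with `dα = 0` and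
`dγ = ½⟨α ∧ α⟩`. -/
def cocycles (T : Triple.{u, v}) : Set (T.C2A × T.C3) :=
  {z | pull2 T.thL T.thA z.1 = z.1 ∧ pull3 T.thL z.2 = z.2 ∧
    d₂₃ ℝ T.L T.A z.1 = 0 ∧
    ∀ x y z' w, dReal3 z.2 x y z' w = (1 / 2) * wedge22 T.form z.1 z.1 x y z' w}

/-- `(α', γ') = (α, γ)(τ, σ)` for the action of quadratic 1-cochains on quadratic 2-cocycles, i.e.
`α' = α + dτ` and `γ' = γ + dσ + ⟨(α + ½ dτ) ∧ τ⟩`. -/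
def IsTranslate (T : Triple.{u, v}) (z z' : T.C2A × T.C3) (t : T.L →ₗ[ℝ] T.A) (s : T.C2) : Prop :=
  z'.1 = z.1 + d₁₂ ℝ T.L T.A t ∧
  ∀ x y w, z'.2 ![x, y, w] = z.2 ![x, y, w] + dReal2 s x y w
    + wedge21 T.form (z.1 + (1 / 2 : ℝ) • d₁₂ ℝ T.L T.A t) t x y w

/-- Two `Θ`-invariant cocycles are equivalent if they lie in the same orbit under the group
`C¹_Q(𝔩, 𝔞)₊` of `Θ`-invariant quadratic 1-cochains `(τ, σ)`. -/
def CohomRel (T : Triple.{u, v}) (z z' : T.cocycles) : Prop :=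
  ∃ (t : T.L →ₗ[ℝ] T.A) (s : T.C2),
    (∀ x, T.thA (t (T.thL x)) = t x) ∧ pull2 T.thL LinearMap.id s = s ∧
    T.IsTranslate z.val z'.val t s

theorem form_comm (T : Triple.{u, v}) (a b : T.A) : T.form a b = T.form b a :=
  T.form_symm.eq a b

theorem form_lie_left (T : Triple.{u, v}) (x : T.L) (a b : T.A) :
    T.form ⁅x, a⁆ b = - T.form ⁅x, b⁆ a := by
  have h := T.form_inv x a b
  rw [T.form_comm a] at h
  linarith

/-- The 2-cochain `⟨t₁ ∧ t₂⟩` for two 1-cochains. -/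
def wedge11 (T : Triple.{u, v}) (t₁ t₂ : T.L →ₗ[ℝ] T.A) : T.C2 :=
  ⟨LinearMap.compl₁₂ T.form t₁ t₂ - (LinearMap.compl₁₂ T.form t₁ t₂).flip, fun x => by simp⟩

theorem wedge11_apply (T : Triple.{u, v}) (t₁ t₂ : T.L →ₗ[ℝ] T.A) (x y : T.L) :
    T.wedge11 t₁ t₂ x y = T.form (t₁ x) (t₂ y) - T.form (t₁ y) (t₂ x) := rfl

theorem dReal2_lin (T : Triple.{u, v}) (c c' : ℝ) (s s' : T.C2) (x y w : T.L) :
    dReal2 (c • s + c' • s') x y w = c * dReal2 s x y w + c' * dReal2 s' x y w := by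
  simp only [dReal2, add_apply_apply, smul_apply_apply, smul_eq_mul]
  ring

theorem pull2_lin (T : Triple.{u, v}) (c c' : ℝ) (s s' : T.C2) :
    pull2 T.thL LinearMap.id (c • s + c' • s')
      = c • pull2 T.thL LinearMap.id s + c' • pull2 T.thL LinearMap.id s' := by
  ext x y
  simp [pull2]

theorem wedge21_apply (T : Triple.{u, v}) (a : T.C2A) (r : ℝ) (t t' : T.L →ₗ[ℝ] T.A)
    (x y w : T.L) :
    wedge21 T.form (a + r • d₁₂ ℝ T.L T.A t) t' x y w = wedge21 T.form a t' x y w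
      + r * wedge21 T.form (d₁₂ ℝ T.L T.A t) t' x y w := by
  simp only [wedge21, add_apply_apply, smul_apply_apply, map_add, map_smul, LinearMap.add_apply,
    LinearMap.smul_apply, smul_eq_mul]
  ring

theorem wedge21_add_right (T : Triple.{u, v}) (a : T.C2A) (t t' : T.L →ₗ[ℝ] T.A) (x y w : T.L) :
    wedge21 T.form a (t + t') x y w = wedge21 T.form a t x y w + wedge21 T.form a t' x y w := by
  simp only [wedge21, LinearMap.add_apply, map_add]
  ring

theorem wedge21_smul_right (T : Triple.{u, v}) (a : T.C2A) (c : ℝ) (t : T.L →ₗ[ℝ] T.A)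
    (x y w : T.L) : wedge21 T.form a (c • t) x y w = c * wedge21 T.form a t x y w := by
  simp only [wedge21, LinearMap.smul_apply, map_smul, smul_eq_mul]
  ring

theorem dReal2_wedge11 (T : Triple.{u, v}) (t t' : T.L →ₗ[ℝ] T.A) (x y w : T.L) :
    dReal2 (T.wedge11 t t') x y w = wedge21 T.form (d₁₂ ℝ T.L T.A t) t' x y w
      - wedge21 T.form (d₁₂ ℝ T.L T.A t') t x y w := by
  simp only [dReal2, wedge11_apply, wedge21, d₁₂_apply_apply, map_sub, LinearMap.sub_apply]
  rw [T.form_lie_left x (t y) (t' w), T.form_lie_left y (t x) (t' w),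
    T.form_lie_left x (t w) (t' y), T.form_lie_left w (t x) (t' y),
    T.form_lie_left y (t w) (t' x), T.form_lie_left w (t y) (t' x),
    T.form_comm (t w) (t' ⁅x, y⁆), T.form_comm (t y) (t' ⁅x, w⁆), T.form_comm (t x) (t' ⁅y, w⁆)]
  ring

theorem cohomRel_equivalence (T : Triple.{u, v}) : Equivalence T.CohomRel := by
  refine ⟨fun z => ⟨0, (0 : ℝ) • T.wedge11 0 0 + (0 : ℝ) • T.wedge11 0 0, by simp, ?_, ?_, ?_⟩,
    ?_, ?_⟩
  · rw [pull2_lin]; simp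
  · simp
  · intro x y w
    rw [dReal2_lin, wedge21_apply T]
    simp [wedge21]
  · rintro z z' ⟨t, s, ht, hs, h1, h2⟩
    refine ⟨(-1 : ℝ) • t, (-1 : ℝ) • s + (0 : ℝ) • s, fun x => by simp [ht], ?_, ?_, ?_⟩
    · rw [pull2_lin, hs]
    · rw [h1, map_smul]; module
    · intro x y w
      rw [dReal2_lin, h2 x y w, wedge21_apply T, wedge21_smul_right,
        map_smul, h1]
      simp only [wedge21, add_apply_apply, smul_apply_apply, map_add, map_smul,
        LinearMap.add_apply, LinearMap.smul_apply, smul_eq_mul]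
      ring
  · rintro z z' z'' ⟨t, s, ht, hs, h1, h2⟩ ⟨t', s', ht', hs', h1', h2'⟩
    have hw : pull2 T.thL LinearMap.id (T.wedge11 t t') = T.wedge11 t t' := by
      ext x y
      have e1 := T.thA_isom (t (T.thL x)) (t' (T.thL y))
      have e2 := T.thA_isom (t (T.thL y)) (t' (T.thL x))
      rw [ht, ht'] at e1 e2
      simp [pull2, wedge11, e1, e2]
    refine ⟨t + t', (1 : ℝ) • ((1 : ℝ) • s + (1 : ℝ) • s') + (1 / 2 : ℝ) • T.wedge11 t t',
      fun x => by simp [ht, ht'], ?_, ?_, ?_⟩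
    · rw [pull2_lin, pull2_lin, hs, hs', hw]
    · rw [h1', h1, map_add]; module
    · intro x y w
      rw [h2' x y w, h2 x y w, h1, dReal2_lin, dReal2_lin, dReal2_wedge11]
      simp only [map_add, wedge21_add_right]
      simp only [wedge21, add_apply_apply, smul_apply_apply, map_add, map_smul,
        LinearMap.add_apply, LinearMap.smul_apply, smul_eq_mul]
      ring

/-- The equivalence relation whose classes are the orbits of the group of `Θ`-invariant quadratic
1-cochains. -/
def cohomSetoid (T : Triple.{u, v}) : Setoid T.cocycles := ⟨T.CohomRel, T.cohomRel_equivalence⟩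

/-- The quadratic cohomology set `H²_Q(𝔩, θ_𝔩, 𝔞)`. -/
def HQ (T : Triple.{u, v}) : Type (max u v) := Quotient T.cohomSetoid

/-- The class `[α, γ]` of a `Θ`-invariant quadratic cocycle. -/
def cls (T : Triple.{u, v}) (z : T.cocycles) : T.HQ := Quotient.mk T.cohomSetoid z

/-- The `(-1)`-eigenspace `𝔩₋` of `θ_𝔩`. -/
def Lminus (T : Triple.{u, v}) : Submodule ℝ T.L :=
  LinearMap.ker ((T.thL : T.L →ₗ[ℝ] T.L) + LinearMap.id)

/-- The fixed space `𝔩₊` of `θ_𝔩`. -/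
def Lplus (T : Triple.{u, v}) : Submodule ℝ T.L :=
  LinearMap.ker ((T.thL : T.L →ₗ[ℝ] T.L) - LinearMap.id)

/-- The condition `(T₁)`: `[𝔩₋, 𝔩₋] = 𝔩₊`. -/
def CondT1 (T : Triple.{u, v}) : Prop :=
  Submodule.span ℝ {w | ∃ x ∈ T.Lminus, ∃ y ∈ T.Lminus, w = ⁅x, y⁆} = T.Lplus

/-- The invariants `𝔞^𝔩`. -/
def inv (T : Triple.{u, v}) : Submodule ℝ T.A := (LieModule.maxTrivSubmodule ℝ T.L T.A).toSubmodule

/-- The subspace `ρ(𝔩)𝔞`, spanned by all `ρ(L)A`. -/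
def coinv (T : Triple.{u, v}) : Submodule ℝ T.A :=
  Submodule.span ℝ {w | ∃ (x : T.L) (a : T.A), w = ⁅x, a⁆}

/-- The fixed space `𝔞₊` of `θ_𝔞`. -/
def Aplus (T : Triple.{u, v}) : Submodule ℝ T.A := LinearMap.ker (T.thA - LinearMap.id)

/-- A subspace of `𝔞` is non-degenerate if the form restricted to it is non-degenerate. -/
def IsNondegSub (T : Triple.{u, v}) (W : Submodule ℝ T.A) : Prop := (T.form.restrict W).Nondegenerate

/-- The subspace `α₀(ker [·,·]_V)`, for a subspace `V` of `𝔩`. For semi-simple `𝔞` one has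
`𝔞 = 𝔞^𝔩 ⊕ ρ(𝔩)𝔞`, `α₀` is the `𝔞^𝔩`-component of `α`, and the image of a subspace `W` under
the projection to `𝔞^𝔩` along `ρ(𝔩)𝔞` is `(W + ρ(𝔩)𝔞) ∩ 𝔞^𝔩`. -/
def alphaZeroKer (T : Triple.{u, v}) (al : T.C2A) (V : Submodule ℝ T.L) : Submodule ℝ T.A :=
  (imageKerBracket al V ⊔ T.coinv) ⊓ T.inv

/-- The condition `(A₀)`. -/
def CondA0 (T : Triple.{u, v}) (z : T.C2A × T.C3) : Prop :=
  ∀ x₀ : T.L, (∀ x : T.L, ⁅x, x₀⁆ = 0) → (∀ a : T.A, ⁅x₀, a⁆ = 0) →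
    (∃ (a₀ : T.A) (f₀ : Module.Dual ℝ T.L),
      (∀ x, z.1 x x₀ = ⁅x, a₀⁆) ∧
      ∀ x y, z.2 ![x, x₀, y] = - T.form a₀ (z.1 x y) + f₀ ⁅x, y⁆) →
    x₀ = 0

/-- The condition `(B₀)`. -/
def CondB0 (T : Triple.{u, v}) (z : T.C2A × T.C3) : Prop :=
  T.IsNondegSub (T.alphaZeroKer z.1 ⊤)

/-- The condition `(T₂)`: `𝔞^𝔩₊ = α₀(ker [·,·]_{𝔩₋})`. -/
def CondT2 (T : Triple.{u, v}) (z : T.C2A × T.C3) : Prop :=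
  T.inv ⊓ T.Aplus = T.alphaZeroKer z.1 T.Lminus

/-- The condition `(A_k)`, for `k ≥ 1`. -/
def CondA (T : Triple.{u, v}) (k : ℕ) (z : T.C2A × T.C3) : Prop :=
  ∀ I : LieIdeal ℝ T.L, I ≤ socleIdeal T.L ⊓ radSeries T.L k →
    (∃ (f₁ : ↥I →ₗ[ℝ] T.A) (f₂ : ↥I →ₗ[ℝ] Module.Dual ℝ ↥(radSeries T.L k)),
      (∀ (x : T.L) (y : ↥I), z.1 x (y : T.L) = ⁅x, f₁ y⁆ - f₁ ⁅x, y⁆) ∧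
      ∀ (x : T.L) (y : ↥I) (w : ↥(radSeries T.L k)),
        z.2 ![x, (y : T.L), (w : T.L)] =
          - T.form (f₁ y) (z.1 x (w : T.L)) + f₂ y ⁅x, w⁆ + f₂ ⁅x, y⁆ w) →
    I = ⊥

/-- The condition `(B_k)`, for `k ≥ 1`: the greatest submodule `𝔟_k` of `𝔞` for which the
displayed system has a solution `f` is non-degenerate. -/
def CondB (T : Triple.{u, v}) (k : ℕ) (z : T.C2A × T.C3) : Prop :=
  ∃ N : LieSubmodule ℝ T.L T.A,
    IsGreatest {N : LieSubmodule ℝ T.L T.A | ∃ f : ↥(radSeries T.L k) →ₗ[ℝ] T.A,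
      ∀ (x : T.L) (y : ↥(radSeries T.L k)), ∀ b ∈ N,
        T.form (z.1 x (y : T.L)) b = T.form (⁅x, f y⁆ - f ⁅x, y⁆) b} N ∧
    T.IsNondegSub N.toSubmodule

/-- The conditions `(T₂)`, `(A_k)`, `(B_k)` for all `k ≥ 0`. (If `R_k(𝔩) = 0`, then `(A_k)` and
`(B_k)` hold trivially, so only the `k ≤ m` with `R_{m+1}(𝔩) = 0` matter.) -/
def IsAdmissibleCocycle (T : Triple.{u, v}) (z : T.C2A × T.C3) : Prop :=
  T.CondT2 z ∧ T.CondA0 z ∧ T.CondB0 z ∧ ∀ k, 1 ≤ k → T.CondA k z ∧ T.CondB k z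

/-- The set `H²_Q(𝔩, θ_𝔩, 𝔞)_♯` of admissible classes. -/
def HQsharp (T : Triple.{u, v}) : Set T.HQ :=
  {p | ∃ z : T.cocycles, T.cls z = p ∧ T.IsAdmissibleCocycle z.val}

/-- Morphisms of triples `(S, U) : (𝔩₁, θ₁, 𝔞₁) → (𝔩₂, θ₂, 𝔞₂)`; note that `U` is an isometric
embedding `𝔞₂ → 𝔞₁`. -/
structure Hom (T₁ T₂ : Triple.{u, v}) where
  S : T₁.L →ₗ⁅ℝ⁆ T₂.L
  U : T₂.A →ₗ[ℝ] T₁.A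
  isometry : ∀ a b, T₁.form (U a) (U b) = T₂.form a b
  injective : Function.Injective U
  equivariant : ∀ (x : T₁.L) (a : T₂.A), U ⁅S x, a⁆ = ⁅x, U a⁆
  comm_thL : ∀ x, S (T₁.thL x) = T₂.thL (S x)
  comm_thA : ∀ a, U (T₂.thA a) = T₁.thA (U a)

/-- The action of a direct sum of Lie algebras on a direct sum of modules:
`(x₁, x₂)(a₁, a₂) = (x₁ a₁, x₂ a₂)`. -/
abbrev prodLieRingModule (T₁ T₂ : Triple.{u, v}) : LieRingModule (T₁.L × T₂.L) (T₁.A × T₂.A) where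
  bracket x a := (⁅x.1, a.1⁆, ⁅x.2, a.2⁆)
  add_lie x y a := by ext <;> simp
  lie_add x a b := by ext <;> simp
  leibniz_lie x y a := by ext <;> simp

/-- The direct sum `(𝔩₁, θ₁, 𝔞₁) ⊕ (𝔩₂, θ₂, 𝔞₂)`. -/
def sum (T₁ T₂ : Triple.{u, v}) : Triple.{u, v} :=
  letI : LieRingModule (T₁.L × T₂.L) (T₁.A × T₂.A) := prodLieRingModule T₁ T₂
  { L := T₁.L × T₂.L
    A := T₁.A × T₂.A
    lieModule :=
      { smul_lie := fun c x a => Prod.ext (smul_lie c x.1 a.1) (smul_lie c x.2 a.2)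
        lie_smul := fun c x a => Prod.ext (lie_smul c x.1 a.1) (lie_smul c x.2 a.2) }
    thL := LieHom.prodMap T₁.thL T₂.thL
    thL_invol := fun x => Prod.ext (T₁.thL_invol x.1) (T₂.thL_invol x.2)
    form := T₁.form.compl₁₂ (LinearMap.fst ℝ T₁.A T₂.A) (LinearMap.fst ℝ T₁.A T₂.A)
      + T₂.form.compl₁₂ (LinearMap.snd ℝ T₁.A T₂.A) (LinearMap.snd ℝ T₁.A T₂.A)
    form_symm := ⟨fun a b => by
      simp [T₁.form_comm a.1, T₂.form_comm a.2]⟩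
    form_nondeg := by
      refine ⟨fun a h => ?_, fun a h => ?_⟩
      · refine Prod.ext (T₁.form_nondeg.1 _ fun b => ?_) (T₂.form_nondeg.1 _ fun b => ?_)
        · simpa using h (b, 0)
        · simpa using h (0, b)
      · refine Prod.ext (T₁.form_nondeg.2 _ fun b => ?_) (T₂.form_nondeg.2 _ fun b => ?_)
        · simpa using h (b, 0)
        · simpa using h (0, b)
    form_inv := fun x a b => by
      have h₁ := T₁.form_inv x.1 a.1 b.1
      have h₂ := T₂.form_inv x.2 a.2 b.2
      change (T₁.form ⁅x.1, a.1⁆ b.1 + T₂.form ⁅x.2, a.2⁆ b.2)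
        + (T₁.form a.1 ⁅x.1, b.1⁆ + T₂.form a.2 ⁅x.2, b.2⁆) = 0
      linarith
    thA := LinearMap.prodMap T₁.thA T₂.thA
    thA_invol := fun a => Prod.ext (T₁.thA_invol a.1) (T₂.thA_invol a.2)
    thA_isom := fun a b => by simp [T₁.thA_isom, T₂.thA_isom]
    compat := fun x a => Prod.ext (T₁.compat x.1 a.1) (T₂.compat x.2 a.2) }

/-- A pair of morphisms `f_i = (q_i, j_i) : T → T_i` is a non-trivial decomposition of `T` if both
are non-zero and `f₁ ⊕ f₂ : T → T₁ ⊕ T₂`, with components `x ↦ (q₁ x, q₂ x)` and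
`(a₁, a₂) ↦ j₁ a₁ + j₂ a₂`, is an isomorphism of triples. -/
def IsNontrivialDecomp {T T₁ T₂ : Triple.{u, v}} (f₁ : T.Hom T₁) (f₂ : T.Hom T₂) : Prop :=
  ¬ (f₁.S = 0 ∧ f₁.U = 0) ∧ ¬ (f₂.S = 0 ∧ f₂.U = 0) ∧
  ∃ g : T.Hom (sum T₁ T₂),
    (∀ x, g.S x = (f₁.S x, f₂.S x)) ∧
    (∀ (a : T₁.A) (b : T₂.A), g.U (a, b) = f₁.U a + f₂.U b) ∧
    Function.Bijective g.S ∧ Function.Bijective g.U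

/-- A class is decomposable if it has the form `f₁^* φ₁ + f₂^* φ₂` for a non-trivial decomposition
`(f₁, f₂)` and classes `φ_i = [α_i, γ_i]`; the sum is formed on representatives. -/
def IsDecomposable (T : Triple.{u, v}) (p : T.HQ) : Prop :=
  ∃ (T₁ T₂ : Triple.{u, v}) (f₁ : T.Hom T₁) (f₂ : T.Hom T₂), IsNontrivialDecomp f₁ f₂ ∧
    ∃ (z₁ : T₁.cocycles) (z₂ : T₂.cocycles) (z : T.cocycles),
      z.val.1 = pull2 f₁.S f₁.U z₁.val.1 + pull2 f₂.S f₂.U z₂.val.1 ∧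
      z.val.2 = pull3 f₁.S z₁.val.2 + pull3 f₂.S z₂.val.2 ∧
      T.cls z = p

/-- The set `H²_Q(𝔩, θ_𝔩, 𝔞)₀` of indecomposable admissible classes. -/
def HQzero (T : Triple.{u, v}) : Set T.HQ := {p | p ∈ T.HQsharp ∧ ¬ T.IsDecomposable p}

end Triple

end QuadCoh

end

/-! Both algebras have a basis with cyclic brackets `⁅e 1, e 2⁆ = a • e 0`, `⁅e 2, e 0⁆ = b • e 1`,
`⁅e 0, e 1⁆ = c • e 2` and `a`, `b`, `c` nonzero, and everything is derived from such a basis. A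
double bracket with basis vectors isolates one coordinate, so the algebra is simple. This yields
`(T₁)`, because `[𝔩₋, 𝔩₋] + 𝔩₋` is an ideal, nonzero when the involution is not the identity.

The bijection with 3-forms rests on `H²(𝔩, 𝔞) = 0`. Here this is a vector calculus argument: in the
basis a 2-cocycle is a divergence-free triple of vectors, and curl of curl is the Casimir operator
minus gradient of divergence, so the Casimir multiple of a cocycle is exact (`curl_curl`). The
Casimir operator commutes with the action and its kernel consists of invariants only
(`mem_maxTrivSubmodule_of_casimir_eq_zero`); hence it is bijective on a complement of the
invariants, while invariant values have an explicit primitive. Averaging makes a primitive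
`Θ`-invariant, so every class has a representative `(0, γ)`. Conversely, every 3-form is a multiple
of the Cartan form of the Killing form, hence closed and fixed by automorphisms. Exact 3-forms
vanish, so `γ` is determined by its class.

If there are no invariants, the admissibility conditions hold because the centre and all `R_k` with
`k ≥ 1` vanish. In a decomposition both Lie algebra components would be injective by simplicity,
which contradicts surjectivity onto the direct sum. If there are invariants, they split off
orthogonally as a triple over the zero algebra, and `[0, γ]` is the sum of `[0, γ]` and `[0, 0]`. -/

namespace QuadCoh

open Module

/-! ### Operators of an `sl₂`-triple with vanishing Casimir operator. -/

section SlTwoTriple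

variable {K W : Type*} [Field K] [CharZero K] [AddCommGroup W] [Module K W] [FiniteDimensional K W]

/-- The power `X ^ n` satisfies `[H, X ^ n] = 2n X ^ n`. If no power vanished, the operator `[H, ·]`
on a finite-dimensional space would have infinitely many eigenvalues. -/
theorem isNilpotent_of_commutator_eq_smul (H X : Module.End K W) (hX : H * X - X * H = (2 : K) • X) :
    IsNilpotent X := by
  let D : Module.End K (Module.End K W) := LinearMap.mulLeft K H - LinearMap.mulRight K H
  have hD : ∀ n : ℕ, D (X ^ n) = (2 * n : K) • X ^ n := by
    intro n
    induction n with
    | zero => simp [D]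
    | succ n ih =>
      have h1 : H * X ^ n - X ^ n * H = (2 * n : K) • X ^ n := ih
      change H * X ^ (n + 1) - X ^ (n + 1) * H = _
      calc H * X ^ (n + 1) - X ^ (n + 1) * H
          = (H * X ^ n - X ^ n * H) * X + X ^ n * (H * X - X * H) := by
            rw [pow_succ]; noncomm_ring
        _ = _ := by
            rw [h1, hX, smul_mul_assoc, mul_smul_comm, ← pow_succ, ← add_smul]
            push_cast
            ring_nf
  by_contra hn
  have hne : ∀ n : ℕ, X ^ n ≠ 0 := fun n h => hn ⟨n, h⟩
  have hinj : Function.Injective (fun n : ℕ => (2 * n : K)) := by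
    intro m n h
    simpa using h
  refine Set.infinite_of_injective_forall_mem hinj (fun n => ?_) (End.finite_hasEigenvalue D)
  exact End.hasEigenvalue_of_hasEigenvector ⟨End.mem_eigenspace_iff.mpr (hD n), hne n⟩

/-- Since `X` is nilpotent, it suffices that `X² v = 0` implies `X v = 0`. This follows from the two
forms `H(H + 2) = -4YX` and `H(H - 2) = -4XY` of the Casimir relation, once `-2` is known not to be
an eigenvalue of `H`. -/
theorem raising_eq_zero_of_casimir_eq_zero (H X Y : Module.End K W)
    (hX : H * X - X * H = (2 : K) • X) (hY : H * Y - Y * H = -((2 : K) • Y))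
    (hXY : X * Y - Y * X = H) (hC : H * H + (2 : K) • H + (4 : K) • (Y * X) = 0) : X = 0 := by
  have hHY : ∀ w, H (Y w) = Y (H w) - (2 : K) • Y w := fun w => by
    have := congrArg (fun f => f w) hY
    simp only [LinearMap.sub_apply, Module.End.mul_apply, LinearMap.neg_apply,
      LinearMap.smul_apply] at this
    rw [sub_eq_iff_eq_add] at this
    rw [this]; abel
  have hHX : ∀ w, H (X w) = X (H w) + (2 : K) • X w := fun w => by
    have := congrArg (fun f => f w) hX
    simp only [LinearMap.sub_apply, Module.End.mul_apply, LinearMap.smul_apply] at this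
    rw [sub_eq_iff_eq_add] at this
    rw [this]; abel
  have hC' : ∀ w, (4 : K) • X (Y w) = -(H (H w)) + (2 : K) • H w := fun w => by
    have h1 := congrArg (fun f => f w) hC
    have h2 := congrArg (fun f => f w) hXY
    simp only [LinearMap.sub_apply, LinearMap.add_apply, Module.End.mul_apply,
      LinearMap.smul_apply, LinearMap.zero_apply] at h1 h2
    rw [sub_eq_iff_eq_add] at h2
    rw [h2, smul_add, ← sub_eq_zero]
    rw [← h1]
    module
  have hC'' : ∀ w, H (H w + (2 : K) • w) = -((4 : K) • Y (X w)) := fun w => by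
    have h1 := congrArg (fun f => f w) hC
    simp only [LinearMap.add_apply, Module.End.mul_apply,
      LinearMap.smul_apply, LinearMap.zero_apply] at h1
    rw [map_add, map_smul]
    exact eq_neg_of_add_eq_zero_left h1
  -- A vector of weight `-2` would generate nonzero vectors `Y ^ k v` of weights `-(2 + 2k)` for all
  -- `k`: on such a vector `4XY` is the scalar `-(2 + 2k)(4 + 2k) ≠ 0`, so `Y` cannot kill it.
  have hinj : ∀ v, H v + (2 : K) • v = 0 → v = 0 := by
    intro v hv
    by_contra hne
    have hw : ∀ k : ℕ, H ((Y ^ k) v) = (-(2 + 2 * k) : K) • (Y ^ k) v := by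
      intro k
      induction k with
      | zero => simpa using eq_neg_of_add_eq_zero_left hv
      | succ k ih =>
        rw [pow_succ', Module.End.mul_apply, hHY, ih, map_smul]
        push_cast
        module
    have hnz : ∀ k : ℕ, (Y ^ k) v ≠ 0 := by
      intro k
      induction k with
      | zero => simpa using hne
      | succ k ih =>
        intro h0
        rw [pow_succ', Module.End.mul_apply] at h0
        have h1 := hC' ((Y ^ k) v)
        rw [h0, map_zero, smul_zero, hw, map_smul, hw, smul_smul, smul_smul, ← neg_smul, ← add_smul,
          eq_comm, smul_eq_zero] at h1
        rcases h1 with h1 | h1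
        · have h2 : (((2 + 2 * k) * (4 + 2 * k) : ℕ) : K) = 0 := by
            push_cast
            linear_combination -h1
          rw [Nat.cast_eq_zero] at h2
          simp at h2
        · exact ih h1
    have hinj : Function.Injective (fun n : ℕ => (-(2 + 2 * n) : K)) := by
      intro m n h
      simpa using h
    refine Set.infinite_of_injective_forall_mem hinj (fun n => ?_) (End.finite_hasEigenvalue H)
    exact End.hasEigenvalue_of_hasEigenvector ⟨End.mem_eigenspace_iff.mpr (hw n), hnz n⟩
  -- On `ker X` the relation reads `(H + 2) H v = 0`, and `H + 2` is injective.
  have hker : ∀ v, X v = 0 → H v = 0 := by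
    intro v hv
    refine hinj _ ?_
    have := hC'' v
    rw [hv, map_zero, smul_zero, neg_zero, map_add, map_smul] at this
    exact this
  have hker2 : ∀ v, X (X v) = 0 → X v = 0 := by
    intro v hv
    -- `X(H + 2)v = H X v`, which vanishes because `X v` lies in `ker X`. Then `(H + 2)v` lies in
    -- `ker X` too, which forces `H v = 0`, and the equation reduces to `2 X v = 0`.
    have h1 : X (H v + (2 : K) • v) = 0 := by
      rw [map_add, map_smul, ← hHX, hker _ hv]
    have h2 : H v = 0 := by
      refine hinj _ ?_
      have := hker _ h1
      rw [map_add, map_smul] at this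
      exact this
    rw [map_add, map_smul, h2, map_zero, zero_add, smul_eq_zero] at h1
    exact h1.resolve_left two_ne_zero
  obtain ⟨n, hn⟩ := isNilpotent_of_commutator_eq_smul H X hX
  have hall : ∀ n : ℕ, ∀ v, (X ^ (n + 1)) v = 0 → X v = 0 := by
    intro n
    induction n with
    | zero => intro v hv; simpa using hv
    | succ n ih =>
      intro v hv
      rw [pow_succ, Module.End.mul_apply] at hv
      exact hker2 v (ih _ hv)
  ext v
  exact hall n v (by rw [pow_succ', hn, mul_zero, LinearMap.zero_apply])

end SlTwoTriple

/-! ### Cyclic bases of `su(2)` and `sl(2, ℝ)`. -/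

/-- A basis `e` of a Lie algebra with `[e 1, e 2] = a e 0`, `[e 2, e 0] = b e 1`,
`[e 0, e 1] = c e 2` and nonzero structure constants `a, b, c`. -/
structure CyclicBasis (L : Type*) [LieRing L] [LieAlgebra ℝ L] where
  e : Basis (Fin 3) ℝ L
  a : ℝ
  b : ℝ
  c : ℝ
  ha : a ≠ 0
  hb : b ≠ 0
  hc : c ≠ 0
  lie12 : ⁅e 1, e 2⁆ = a • e 0
  lie20 : ⁅e 2, e 0⁆ = b • e 1
  lie01 : ⁅e 0, e 1⁆ = c • e 2

section Existence

attribute [local instance 100] LieRing.ofAssociativeRing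

noncomputable def su2Equiv : su2 ≃ₗ[ℝ] (Fin 3 → ℝ) where
  toFun X := ![(X.val 0 0).im, (X.val 0 1).re, (X.val 0 1).im]
  map_add' X Y := by ext i; fin_cases i <;> simp
  map_smul' r X := by ext i; fin_cases i <;> simp
  invFun w := ⟨!![⟨0, w 0⟩, ⟨w 1, w 2⟩; ⟨-w 1, w 2⟩, ⟨0, -w 0⟩], by
    constructor
    · ext i j
      fin_cases i <;> fin_cases j <;> simp [Complex.ext_iff]
    · simp [Matrix.trace_fin_two, Complex.ext_iff]⟩
  left_inv := by
    rintro ⟨X, hX, hX'⟩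
    have h00 := congrFun (congrFun hX 0) 0
    have h01 := congrFun (congrFun hX 0) 1
    have h11 := congrFun (congrFun hX 1) 1
    simp [Complex.ext_iff] at h00 h01 h11
    simp [Matrix.trace_fin_two, Complex.ext_iff] at hX'
    ext i j
    fin_cases i <;> fin_cases j <;> simp [Complex.ext_iff] <;>
      first | (constructor <;> linarith) | linarith
  right_inv w := by ext i; fin_cases i <;> simp

/-- The off-diagonal entries are split into symmetric and skew parts, because the standard basis
with `H`, `X`, `Y` does not have cyclic brackets. -/
noncomputable def sl2Equiv : LieAlgebra.SpecialLinear.sl (Fin 2) ℝ ≃ₗ[ℝ] (Fin 3 → ℝ) where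
  toFun X := ![X.val 0 0, (X.val 0 1 + X.val 1 0) / 2, (X.val 0 1 - X.val 1 0) / 2]
  map_add' X Y := by ext i; fin_cases i <;> simp <;> ring
  map_smul' r X := by ext i; fin_cases i <;> simp <;> ring
  invFun w := ⟨!![w 0, w 1 + w 2; w 1 - w 2, - w 0], by
    change Matrix.trace (n := Fin 2) _ = 0
    simp [Matrix.trace_fin_two]⟩
  left_inv := by
    rintro ⟨X, hX⟩
    have hX : Matrix.trace (n := Fin 2) X = 0 := hX
    simp [Matrix.trace_fin_two] at hX
    ext i j
    fin_cases i <;> fin_cases j <;> simp <;> linarith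
  right_inv w := by ext i; fin_cases i <;> simp

noncomputable def CyclicBasis.su2 : CyclicBasis QuadCoh.su2 where
  e := Basis.ofEquivFun su2Equiv
  a := 2
  b := 2
  c := 2
  ha := by norm_num
  hb := by norm_num
  hc := by norm_num
  lie12 := by
    apply Subtype.ext
    ext i j
    fin_cases i <;> fin_cases j <;> simp [Complex.ext_iff, Ring.lie_def, su2Equiv] <;> norm_num
  lie20 := by
    apply Subtype.ext
    ext i j
    fin_cases i <;> fin_cases j <;> simp [Complex.ext_iff, Ring.lie_def, su2Equiv] <;> norm_num
  lie01 := by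
    apply Subtype.ext
    ext i j
    fin_cases i <;> fin_cases j <;> simp [Complex.ext_iff, Ring.lie_def, su2Equiv] <;> norm_num

noncomputable def CyclicBasis.sl2 : CyclicBasis (LieAlgebra.SpecialLinear.sl (Fin 2) ℝ) where
  e := Basis.ofEquivFun sl2Equiv
  a := -2
  b := -2
  c := 2
  ha := by norm_num
  hb := by norm_num
  hc := by norm_num
  lie12 := by
    apply Subtype.ext
    ext i j
    fin_cases i <;> fin_cases j <;> simp [Ring.lie_def, sl2Equiv] <;> norm_num
  lie20 := by
    apply Subtype.ext
    ext i j
    fin_cases i <;> fin_cases j <;> simp [Ring.lie_def, sl2Equiv] <;> norm_num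
  lie01 := by
    apply Subtype.ext
    ext i j
    fin_cases i <;> fin_cases j <;> simp [Ring.lie_def, sl2Equiv] <;> norm_num

variable {L M : Type*} [LieRing L] [LieAlgebra ℝ L] [LieRing M] [LieAlgebra ℝ M]

noncomputable def CyclicBasis.transport (s : CyclicBasis M) (f : L ≃ₗ⁅ℝ⁆ M) : CyclicBasis L where
  e := s.e.map f.symm.toLinearEquiv
  a := s.a
  b := s.b
  c := s.c
  ha := s.ha
  hb := s.hb
  hc := s.hc
  lie12 := by
    exact (f.symm.map_lie _ _).symm.trans ((congrArg f.symm s.lie12).trans (map_smul f.symm _ _))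
  lie20 := by
    exact (f.symm.map_lie _ _).symm.trans ((congrArg f.symm s.lie20).trans (map_smul f.symm _ _))
  lie01 := by
    exact (f.symm.map_lie _ _).symm.trans ((congrArg f.symm s.lie01).trans (map_smul f.symm _ _))

theorem IsSu2OrSl2.nonempty_cyclicBasis (h : IsSu2OrSl2 L) : Nonempty (CyclicBasis L) := by
  rcases h with ⟨⟨f⟩⟩ | ⟨⟨f⟩⟩
  · exact ⟨CyclicBasis.su2.transport f⟩
  · exact ⟨CyclicBasis.sl2.transport f⟩

end Existence

/-! ### A vanishing Casimir operator forces a trivial action. -/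

theorem eq_zero_of_cyclic_relations {W : Type*} [AddCommGroup W] [Module ℂ W]
    [FiniteDimensional ℂ W] {E₀ E₁ E₂ : Module.End ℂ W} {a b c : ℂ} (ha : a ≠ 0) (hb : b ≠ 0)
    (hc : c ≠ 0) (e01 : E₀ * E₁ = E₁ * E₀ + c • E₂) (e12 : E₁ * E₂ = E₂ * E₁ + a • E₀)
    (e20 : E₂ * E₀ = E₀ * E₂ + b • E₁)
    (hC : E₂ * E₂ = (-(a / c)) • (E₀ * E₀) + (-(b / c)) • (E₁ * E₁)) : E₂ = 0 := by
  -- `±m` are the nonzero eigenvalues of `ad e₂` on the complexified algebra. The factor `2 / m`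
  -- normalizes `e₂` to the `H` of an `sl₂`-triple, and `X`, `Y` are multiples of the eigenvectors
  -- `e₀ ∓ (m / a) e₁`.
  obtain ⟨m, hm⟩ := IsAlgClosed.exists_pow_nat_eq (-(a * b)) (n := 2) two_pos
  have hm0 : m ≠ 0 := by
    rintro rfl
    simp [ha, hb] at hm
  have hX : E₀ - (m / a) • E₁ = 0 := by
    refine raising_eq_zero_of_casimir_eq_zero ((2 / m) • E₂) _
      ((-(1 / (b * c))) • (E₀ + (m / a) • E₁)) ?_ ?_ ?_ ?_
    · simp only [smul_mul_assoc, mul_smul_comm, mul_sub, sub_mul, e20, e12]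
      clear e01 e12 e20 hC
      match_scalars <;> field_simp <;> grind
    · simp only [smul_mul_assoc, mul_smul_comm, mul_add, add_mul, e20, e12]
      clear e01 e12 e20 hC
      match_scalars <;> field_simp <;> grind
    · simp only [smul_mul_assoc, mul_smul_comm, mul_sub, sub_mul, mul_add, add_mul, e01]
      clear e01 e12 e20 hC
      match_scalars <;> field_simp <;> grind
    -- `H² + 2H + 4YX` equals `-4 / (abc)` times `a E₀² + b E₁² + c E₂²`, so it vanishes by `hC`.
    · simp only [smul_mul_assoc, mul_smul_comm, mul_sub, add_mul, e01, hC]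
      clear e01 e12 e20 hC
      match_scalars <;> field_simp <;> grind
  -- Now `E₀` is a multiple of `E₁`, so their commutator `c E₂` is zero.
  rw [sub_eq_zero] at hX
  rw [hX, smul_mul_assoc, mul_smul_comm, left_eq_add, smul_eq_zero] at e01
  exact e01.resolve_left hc

/-! ### The Casimir operator of a module. -/

namespace CyclicBasis

variable {L V : Type*} [LieRing L] [LieAlgebra ℝ L] [AddCommGroup V] [Module ℝ V]
  [LieRingModule L V] [LieModule ℝ L V] (s : CyclicBasis L)

theorem lie10 : ⁅s.e 1, s.e 0⁆ = -(s.c • s.e 2) := by rw [← s.lie01, lie_skew]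

theorem lie21 : ⁅s.e 2, s.e 1⁆ = -(s.a • s.e 0) := by rw [← s.lie12, lie_skew]

theorem lie02 : ⁅s.e 0, s.e 2⁆ = -(s.b • s.e 1) := by rw [← s.lie20, lie_skew]

theorem lie_e1_e0 (w : V) : ⁅s.e 1, ⁅s.e 0, w⁆⁆ = ⁅s.e 0, ⁅s.e 1, w⁆⁆ - s.c • ⁅s.e 2, w⁆ := by
  rw [leibniz_lie, s.lie10, neg_lie, smul_lie]; abel

theorem lie_e2_e1 (w : V) : ⁅s.e 2, ⁅s.e 1, w⁆⁆ = ⁅s.e 1, ⁅s.e 2, w⁆⁆ - s.a • ⁅s.e 0, w⁆ := by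
  rw [leibniz_lie, s.lie21, neg_lie, smul_lie]; abel

theorem lie_e2_e0 (w : V) : ⁅s.e 2, ⁅s.e 0, w⁆⁆ = ⁅s.e 0, ⁅s.e 2, w⁆⁆ + s.b • ⁅s.e 1, w⁆ := by
  rw [leibniz_lie, s.lie20, smul_lie]; abel

theorem expand (x : L) :
    x = s.e.repr x 0 • s.e 0 + s.e.repr x 1 • s.e 1 + s.e.repr x 2 • s.e 2 := by
  conv_lhs => rw [← s.e.sum_repr x]
  rw [Fin.sum_univ_three]

variable (V) in
/-- The Casimir operator of a module. -/
noncomputable def casimir : V →ₗ[ℝ] V :=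
  s.a • (LieModule.toEnd ℝ L V (s.e 0)) ^ 2 + s.b • (LieModule.toEnd ℝ L V (s.e 1)) ^ 2
    + s.c • (LieModule.toEnd ℝ L V (s.e 2)) ^ 2

theorem casimir_apply (v : V) : s.casimir V v =
    s.a • ⁅s.e 0, ⁅s.e 0, v⁆⁆ + s.b • ⁅s.e 1, ⁅s.e 1, v⁆⁆ + s.c • ⁅s.e 2, ⁅s.e 2, v⁆⁆ := by
  simp [casimir, pow_two]

theorem casimir_lie (x : L) (v : V) : s.casimir V ⁅x, v⁆ = ⁅x, s.casimir V v⁆ := by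
  rw [s.expand x]
  simp only [add_lie, smul_lie, map_add, map_smul]
  congr 1
  · congr 1 <;> congr 1 <;>
    · simp only [casimir_apply, lie_e1_e0, lie_e2_e0, lie_e2_e1, lie_add, lie_sub, lie_smul]
      module
  · congr 1
    simp only [casimir_apply, lie_e1_e0, lie_e2_e0, lie_e2_e1, lie_add, lie_sub, lie_smul]
    module

variable [FiniteDimensional ℝ V]

-- After complexification an `sl₂`-triple exists and the operator of `e 2` is zero. The cyclic
-- relations then kill the other two operators, and complexification is faithful.
open TensorProduct in
theorem lie_eq_zero_of_casimir_eq_zero (h : ∀ v : V, s.casimir V v = 0) (x : L) (v : V) :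
    ⁅x, v⁆ = 0 := by
  have ha : (s.a : ℂ) ≠ 0 := Complex.ofReal_ne_zero.mpr s.ha
  have hb : (s.b : ℂ) ≠ 0 := Complex.ofReal_ne_zero.mpr s.hb
  have hc : (s.c : ℂ) ≠ 0 := Complex.ofReal_ne_zero.mpr s.hc
  let Φ := Module.End.baseChangeHom ℝ ℂ V
  let F : Fin 3 → Module.End ℝ V := fun i => LieModule.toEnd ℝ L V (s.e i)
  let E : Fin 3 → Module.End ℂ (ℂ ⊗[ℝ] V) := fun i => Φ (F i)
  have f01 : F 0 * F 1 - F 1 * F 0 = s.c • F 2 := by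
    ext w
    simp [F, s.lie_e1_e0]
  have f12 : F 1 * F 2 - F 2 * F 1 = s.a • F 0 := by
    ext w
    simp [F, s.lie_e2_e1]
  have f20 : F 2 * F 0 - F 0 * F 2 = s.b • F 1 := by
    ext w
    simp [F, s.lie_e2_e0]
  have f0 : s.a • (F 0 * F 0) + s.b • (F 1 * F 1) + s.c • (F 2 * F 2) = 0 := by
    ext w
    simpa [F, casimir_apply] using h w
  have hs : ∀ (r : ℝ) (f : Module.End ℝ V), Φ (r • f) = (r : ℂ) • Φ f := fun r f => by
    rw [map_smul]; exact (algebraMap_smul ℂ r (Φ f)).symm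
  have e01 : E 0 * E 1 = E 1 * E 0 + (s.c : ℂ) • E 2 := by
    rw [← sub_eq_iff_eq_add']; simpa only [map_sub, map_mul, hs] using congrArg Φ f01
  have e12 : E 1 * E 2 = E 2 * E 1 + (s.a : ℂ) • E 0 := by
    rw [← sub_eq_iff_eq_add']; simpa only [map_sub, map_mul, hs] using congrArg Φ f12
  have e20 : E 2 * E 0 = E 0 * E 2 + (s.b : ℂ) • E 1 := by
    rw [← sub_eq_iff_eq_add']; simpa only [map_sub, map_mul, hs] using congrArg Φ f20
  have e0 : E 2 * E 2 = (-(s.a / s.c : ℂ)) • (E 0 * E 0) + (-(s.b / s.c : ℂ)) • (E 1 * E 1) := by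
    have := congrArg Φ f0
    simp only [map_add, map_mul, hs, map_zero] at this
    change (s.a : ℂ) • (E 0 * E 0) + (s.b : ℂ) • (E 1 * E 1) + (s.c : ℂ) • (E 2 * E 2) = 0 at this
    have h2 := congrArg (fun f => (s.c : ℂ)⁻¹ • f) this
    simp only [smul_add, smul_smul, inv_mul_cancel₀ hc, smul_zero, one_smul] at h2
    rw [eq_comm, ← sub_eq_zero, ← neg_eq_zero, ← h2]
    module
  have hinj : ∀ f : Module.End ℝ V, Φ f = 0 → f = 0 := by
    intro f hf
    ext w
    have h1 : (1 : ℂ) ⊗ₜ[ℝ] f w = 0 := by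
      have h2 : LinearMap.baseChange ℂ f = 0 := hf
      rw [← LinearMap.baseChange_tmul, h2, LinearMap.zero_apply]
    exact (FaithfullyFlat.one_tmul_eq_zero_iff ℝ V (f w)).mp h1
  have h2 : F 2 = 0 := hinj _ (eq_zero_of_cyclic_relations ha hb hc e01 e12 e20 e0)
  have h0 : F 0 = 0 := by
    rw [h2, mul_zero, zero_mul, sub_zero, eq_comm, smul_eq_zero] at f12
    exact f12.resolve_left s.ha
  have h1 : F 1 = 0 := by
    rw [h2, mul_zero, zero_mul, sub_zero, eq_comm, smul_eq_zero] at f20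
    exact f20.resolve_left s.hb
  have hF : ∀ i, F i = 0 := by
    intro i
    fin_cases i
    exacts [h0, h1, h2]
  have hv : ∀ i, ⁅s.e i, v⁆ = 0 := fun i => congrArg (fun f => f v) (hF i)
  rw [s.expand x]
  simp [hv]

/-- The Casimir operator commutes with the action, so its kernel is a submodule. On this submodule
it vanishes identically, so the action there is trivial. -/
theorem mem_maxTrivSubmodule_of_casimir_eq_zero {v : V} (h : s.casimir V v = 0) :
    v ∈ LieModule.maxTrivSubmodule ℝ L V := by
  let N : LieSubmodule ℝ L V :=
    { LinearMap.ker (s.casimir V) with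
      lie_mem := fun {x m} hm => by
        have hm : s.casimir V m = 0 := hm
        change s.casimir V ⁅x, m⁆ = 0
        rw [casimir_lie, hm, lie_zero] }
  rw [LieModule.mem_maxTrivSubmodule]
  intro x
  have hN : ∀ w : N, s.casimir N w = 0 := by
    intro w
    apply Subtype.ext
    have hw : s.casimir V w = 0 := w.2
    rw [casimir_apply] at hw ⊢
    exact hw
  exact congrArg Subtype.val (s.lie_eq_zero_of_casimir_eq_zero hN x ⟨v, h⟩)

/-- In a semi-simple module every vector is an invariant one plus a Casimir image from a submodule
on which the Casimir operator is bijective. -/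
theorem exists_complement (hV : IsSemisimpleLie L V) : ∃ N : LieSubmodule ℝ L V,
    IsCompl (LieModule.maxTrivSubmodule ℝ L V) N ∧
    (∀ v ∈ N, s.casimir V v = 0 → v = 0) ∧ ∀ v ∈ N, ∃ w ∈ N, s.casimir V w = v := by
  obtain ⟨N, hN⟩ := hV.exists_isCompl (LieModule.maxTrivSubmodule ℝ L V)
  have hinj : ∀ v ∈ N, s.casimir V v = 0 → v = 0 := by
    intro v hv h
    have h1 : v ∈ LieModule.maxTrivSubmodule ℝ L V ⊓ N :=
      (LieSubmodule.mem_inf _ _ _).mpr ⟨s.mem_maxTrivSubmodule_of_casimir_eq_zero h, hv⟩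
    rwa [hN.inf_eq_bot, LieSubmodule.mem_bot] at h1
  refine ⟨N, hN, hinj, ?_⟩
  have hmap : ∀ v ∈ N.toSubmodule, s.casimir V v ∈ N.toSubmodule := by
    intro v hv
    rw [casimir_apply]
    exact N.add_mem (N.add_mem (N.smul_mem _ (N.lie_mem (N.lie_mem hv)))
      (N.smul_mem _ (N.lie_mem (N.lie_mem hv)))) (N.smul_mem _ (N.lie_mem (N.lie_mem hv)))
  have hsurj : Function.Surjective ((s.casimir V).restrict hmap) := by
    rw [← LinearMap.injective_iff_surjective]
    rw [injective_iff_map_eq_zero]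
    intro w hw
    exact Subtype.ext (hinj w w.2 (congrArg Subtype.val hw))
  intro v hv
  obtain ⟨w, hw⟩ := hsurj ⟨v, hv⟩
  exact ⟨w, w.2, congrArg Subtype.val hw⟩

end CyclicBasis

open LieModule.Cohomology

namespace CyclicBasis

/-! ### Simplicity of the algebra. -/

section Simple

variable {L : Type*} [LieRing L] [LieAlgebra ℝ L] (s : CyclicBasis L)

theorem ideal_eq_top_of_all_mem (I : LieIdeal ℝ L) (h0 : s.e 0 ∈ I) (h1 : s.e 1 ∈ I)
    (h2 : s.e 2 ∈ I) : I = ⊤ := by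
  rw [eq_top_iff]
  intro x _
  rw [s.expand x]
  exact I.add_mem (I.add_mem (I.smul_mem _ h0) (I.smul_mem _ h1)) (I.smul_mem _ h2)

theorem lie_e0 (x : L) : ⁅s.e 0, x⁆ =
    (s.c * s.e.repr x 1) • s.e 2 - (s.b * s.e.repr x 2) • s.e 1 := by
  conv_lhs => rw [s.expand x]
  simp only [lie_add, lie_smul, lie_self, s.lie01, s.lie02]
  module

theorem lie_e1 (x : L) : ⁅s.e 1, x⁆ =
    (s.a * s.e.repr x 2) • s.e 0 - (s.c * s.e.repr x 0) • s.e 2 := by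
  conv_lhs => rw [s.expand x]
  simp only [lie_add, lie_smul, lie_self, s.lie12, s.lie10]
  module

theorem ideal_eq_top (s : CyclicBasis L) {I : LieIdeal ℝ L} (hI : I ≠ ⊥) : I = ⊤ := by
  obtain ⟨x, hx, hx0⟩ : ∃ x ∈ I, x ≠ 0 := by
    by_contra! h
    exact hI ((LieSubmodule.eq_bot_iff I).mpr h)
  have hmem : ∀ (r : ℝ) (y z : L), r ≠ 0 → z ∈ I → z = r • y → y ∈ I := by
    rintro r y z hr hz rfl
    have := I.smul_mem r⁻¹ hz
    rwa [smul_smul, inv_mul_cancel₀ hr, one_smul] at this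
  have h01 : s.e 0 ∈ I → s.e 1 ∈ I := fun h => hmem s.b _ _ s.hb (I.lie_mem (x := s.e 2) h) s.lie20
  have h12 : s.e 1 ∈ I → s.e 2 ∈ I := fun h => hmem s.c _ _ s.hc (I.lie_mem (x := s.e 0) h) s.lie01
  have h20 : s.e 2 ∈ I → s.e 0 ∈ I := fun h => hmem s.a _ _ s.ha (I.lie_mem (x := s.e 1) h) s.lie12
  suffices h : s.e 0 ∈ I from s.ideal_eq_top_of_all_mem I h (h01 h) (h12 (h01 h))
  have hx' : s.e.repr x 0 ≠ 0 ∨ s.e.repr x 1 ≠ 0 ∨ s.e.repr x 2 ≠ 0 := by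
    by_contra! h
    apply hx0
    rw [s.expand x]
    simp [h]
  -- Bracketing with two suitable basis vectors leaves a nonzero multiple of a single basis vector;
  -- the cyclic relations then bring in the other two.
  rcases hx' with h | h | h
  · refine h20 (h12 (hmem (s.b * (s.c * s.e.repr x 0)) _ _ ?_
      (I.lie_mem (x := s.e 0) (I.lie_mem (x := s.e 1) hx)) ?_))
    · simp [s.hb, s.hc, h]
    · rw [s.lie_e1, lie_sub, lie_smul, lie_smul, lie_self, s.lie02]
      module
  · refine hmem (s.c * s.a * s.e.repr x 1) _ _ ?_
      (I.lie_mem (x := s.e 1) (I.lie_mem (x := s.e 0) hx)) ?_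
    · simp [s.ha, s.hc, h]
    · rw [s.lie_e0, lie_sub, lie_smul, lie_smul, lie_self, s.lie12]
      module
  · refine hmem (s.a * (s.b * s.e.repr x 2)) _ _ ?_
      (I.lie_mem (x := s.e 2) (I.lie_mem (x := s.e 0) hx)) ?_
    · simp [s.ha, s.hb, h]
    · rw [s.lie_e0, lie_sub, lie_smul, lie_smul, lie_self, s.lie21]
      module

theorem eq_zero_of_central (s : CyclicBasis L) {x : L} (h : ∀ y : L, ⁅y, x⁆ = 0) : x = 0 := by
  by_contra hx
  have hne : LieModule.maxTrivSubmodule ℝ L L ≠ ⊥ := by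
    intro hbot
    exact hx ((LieSubmodule.eq_bot_iff _).mp hbot x ((LieModule.mem_maxTrivSubmodule _ _ _ _).mpr h))
  have h1 : s.e 2 ∈ LieModule.maxTrivSubmodule ℝ L L := by
    rw [s.ideal_eq_top hne]; exact LieSubmodule.mem_top _
  have h2 := (LieModule.mem_maxTrivSubmodule _ _ _ _).mp h1 (s.e 1)
  rw [s.lie12, smul_eq_zero] at h2
  exact h2.elim s.ha (s.e.ne_zero 0)

end Simple

/-! ### Vanishing of the second cohomology with semi-simple coefficients. -/

section SecondCohomology

variable {L V : Type*} [LieRing L] [LieAlgebra ℝ L] [AddCommGroup V] [Module ℝ V]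
  [LieRingModule L V] [LieModule ℝ L V] (s : CyclicBasis L)

theorem twoCochain_ext {W : Type*} [AddCommGroup W] [Module ℝ W] {f g : twoCochain ℝ L W}
    (h12 : f (s.e 1) (s.e 2) = g (s.e 1) (s.e 2)) (h20 : f (s.e 2) (s.e 0) = g (s.e 2) (s.e 0))
    (h01 : f (s.e 0) (s.e 1) = g (s.e 0) (s.e 1)) : f = g := by
  apply Subtype.ext
  refine s.e.ext fun i => s.e.ext fun j => ?_
  simp only [twoCochain_val_apply]
  have h21 : f (s.e 2) (s.e 1) = g (s.e 2) (s.e 1) := by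
    rw [← twoCochain_skew f, ← twoCochain_skew g, h12]
  have h02 : f (s.e 0) (s.e 2) = g (s.e 0) (s.e 2) := by
    rw [← twoCochain_skew f, ← twoCochain_skew g, h20]
  have h10 : f (s.e 1) (s.e 0) = g (s.e 1) (s.e 0) := by
    rw [← twoCochain_skew f, ← twoCochain_skew g, h01]
  fin_cases i <;> fin_cases j <;> simp [*]

/-- The Casimir multiple of a 2-cocycle is the differential of its metric curl. -/
theorem curl_curl {u₀ u₁ u₂ : V} (h : ⁅s.e 0, u₀⁆ + ⁅s.e 1, u₁⁆ + ⁅s.e 2, u₂⁆ = 0) :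
    ∃ t₀ t₁ t₂ : V, ⁅s.e 1, t₂⁆ - ⁅s.e 2, t₁⁆ - s.a • t₀ = s.casimir V u₀ ∧
      ⁅s.e 2, t₀⁆ - ⁅s.e 0, t₂⁆ - s.b • t₁ = s.casimir V u₁ ∧
      ⁅s.e 0, t₁⁆ - ⁅s.e 1, t₀⁆ - s.c • t₂ = s.casimir V u₂ := by
  -- These are the components of the gradient of the divergence, which is the difference between the
  -- Casimir operator and the iterated curl.
  have h0 := congrArg (fun w => ⁅s.e 0, w⁆) h
  have h1 := congrArg (fun w => ⁅s.e 1, w⁆) h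
  have h2 := congrArg (fun w => ⁅s.e 2, w⁆) h
  simp only [lie_add, lie_zero, lie_e1_e0, lie_e2_e0, lie_e2_e1] at h0 h1 h2
  refine ⟨s.c • ⁅s.e 2, u₁⁆ - s.b • ⁅s.e 1, u₂⁆, s.a • ⁅s.e 0, u₂⁆ - s.c • ⁅s.e 2, u₀⁆,
    s.b • ⁅s.e 1, u₀⁆ - s.a • ⁅s.e 0, u₁⁆, ?_, ?_, ?_⟩
  · simp only [casimir_apply, lie_e1_e0, lie_e2_e0, lie_sub, lie_smul]
    linear_combination (norm := module) (-s.a) • h0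
  · simp only [casimir_apply, lie_e2_e1, lie_sub, lie_smul]
    linear_combination (norm := module) (-s.b) • h1
  · simp only [casimir_apply, lie_sub, lie_smul]
    linear_combination (norm := module) (-s.c) • h2

variable [FiniteDimensional ℝ V]

/-- Each value splits into an invariant `p` and a Casimir image of some `w` in the complement. The
`w`-part is handled by the double curl; on the invariant part the action terms of the differential
vanish, so dividing by the structure constants suffices. -/
theorem exists_primitive (hV : IsSemisimpleLie L V) {u₀ u₁ u₂ : V}
    (h : ⁅s.e 0, u₀⁆ + ⁅s.e 1, u₁⁆ + ⁅s.e 2, u₂⁆ = 0) :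
    ∃ t₀ t₁ t₂ : V, ⁅s.e 1, t₂⁆ - ⁅s.e 2, t₁⁆ - s.a • t₀ = u₀ ∧
      ⁅s.e 2, t₀⁆ - ⁅s.e 0, t₂⁆ - s.b • t₁ = u₁ ∧
      ⁅s.e 0, t₁⁆ - ⁅s.e 1, t₀⁆ - s.c • t₂ = u₂ := by
  obtain ⟨N, hN, hinj, hsurj⟩ := s.exists_complement hV
  have hdec : ∀ u : V, ∃ p : V, (∀ x : L, ⁅x, p⁆ = 0) ∧ ∃ w ∈ N, p + s.casimir V w = u := by
    intro u
    have hu : u ∈ LieModule.maxTrivSubmodule ℝ L V ⊔ N := by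
      rw [hN.sup_eq_top]; exact LieSubmodule.mem_top _
    obtain ⟨p, hp, n, hn, rfl⟩ := (LieSubmodule.mem_sup _ _ _).mp hu
    obtain ⟨w, hw, rfl⟩ := hsurj n hn
    exact ⟨p, (LieModule.mem_maxTrivSubmodule _ _ _ _).mp hp, w, hw, rfl⟩
  obtain ⟨p₀, hp₀, w₀, hw₀, rfl⟩ := hdec u₀
  obtain ⟨p₁, hp₁, w₁, hw₁, rfl⟩ := hdec u₁
  obtain ⟨p₂, hp₂, w₂, hw₂, rfl⟩ := hdec u₂
  -- The preimages again form a cocycle: the Casimir operator commutes with the divergence and is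
  -- injective on `N`.
  have hw : ⁅s.e 0, w₀⁆ + ⁅s.e 1, w₁⁆ + ⁅s.e 2, w₂⁆ = 0 := by
    refine hinj _ (N.add_mem (N.add_mem (N.lie_mem hw₀) (N.lie_mem hw₁)) (N.lie_mem hw₂)) ?_
    simpa only [lie_add, hp₀, hp₁, hp₂, zero_add, map_add, casimir_lie] using h
  obtain ⟨t₀, t₁, t₂, h₀, h₁, h₂⟩ := s.curl_curl hw
  refine ⟨t₀ - s.a⁻¹ • p₀, t₁ - s.b⁻¹ • p₁, t₂ - s.c⁻¹ • p₂, ?_, ?_, ?_⟩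
  · simp only [lie_sub, lie_smul, hp₁, hp₂, smul_zero, smul_sub, smul_inv_smul₀ s.ha, ← h₀]
    abel
  · simp only [lie_sub, lie_smul, hp₀, hp₂, smul_zero, smul_sub, smul_inv_smul₀ s.hb, ← h₁]
    abel
  · simp only [lie_sub, lie_smul, hp₀, hp₁, smul_zero, smul_sub, smul_inv_smul₀ s.hc, ← h₂]
    abel

theorem exists_d₁₂_eq (s : CyclicBasis L) (hV : IsSemisimpleLie L V) {f : twoCochain ℝ L V}
    (hf : d₂₃ ℝ L V f = 0) : ∃ t : L →ₗ[ℝ] V, d₁₂ ℝ L V t = f := by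
  -- Each bracket of two basis vectors is a multiple of the third, so the terms of `d f` containing
  -- a bracket vanish by alternation and only the divergence remains.
  have h : ⁅s.e 0, f (s.e 1) (s.e 2)⁆ + ⁅s.e 1, f (s.e 2) (s.e 0)⁆
      + ⁅s.e 2, f (s.e 0) (s.e 1)⁆ = 0 := by
    have h1 : d₂₃ ℝ L V f (s.e 0) (s.e 1) (s.e 2) = 0 := by rw [hf]; rfl
    rw [d₂₃_apply, s.lie01, s.lie02, s.lie12] at h1
    simp only [map_neg, map_smul, LinearMap.neg_apply, LinearMap.smul_apply, twoCochain_alt,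
      smul_zero, neg_zero, sub_zero, add_zero] at h1
    rw [← twoCochain_skew f (s.e 0) (s.e 2), lie_neg, ← sub_eq_add_neg]
    exact h1
  obtain ⟨t₀, t₁, t₂, h₀, h₁, h₂⟩ := s.exists_primitive hV h
  refine ⟨s.e.constr ℝ ![t₀, t₁, t₂], s.twoCochain_ext ?_ ?_ ?_⟩
  · simpa [d₁₂_apply_apply, s.lie12, Basis.constr_basis] using h₀
  · simpa [d₁₂_apply_apply, s.lie20, Basis.constr_basis] using h₁
  · simpa [d₁₂_apply_apply, s.lie01, Basis.constr_basis] using h₂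

end SecondCohomology

end CyclicBasis

/-! ### Three-forms and the Cartan form. -/

variable {L : Type*} [LieRing L] [LieAlgebra ℝ L]

variable (L) in
/-- The Cartan 3-form `κ([x, y], z)` of the Killing form `κ`. -/
noncomputable def cartanForm : L [⋀^Fin 3]→ₗ[ℝ] ℝ where
  toFun w := killingForm ℝ L ⁅w 0, w 1⁆ (w 2)
  map_update_add' := by
    intro inst w i x y
    obtain rfl : inst = instDecidableEqFin 3 := Subsingleton.elim _ _
    fin_cases i <;> simp [Function.update]
  map_update_smul' := by
    intro inst w i r x
    obtain rfl : inst = instDecidableEqFin 3 := Subsingleton.elim _ _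
    fin_cases i <;> simp [Function.update]
  map_eq_zero_of_eq' := by
    intro w i j h hij
    have h1 : ∀ x y : L, killingForm ℝ L ⁅x, y⁆ y = 0 := fun x y => by
      rw [LieModule.traceForm_apply_lie_apply, lie_self, map_zero]
    have h2 : ∀ x y : L, killingForm ℝ L ⁅x, y⁆ x = 0 := fun x y => by
      rw [LieModule.traceForm_apply_lie_apply', lie_self, map_zero, neg_zero]
    fin_cases i <;> fin_cases j <;> simp_all

theorem cartanForm_apply (x y z : L) : cartanForm L ![x, y, z] = killingForm ℝ L ⁅x, y⁆ z := rfl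

/-- Invariance of the Killing form rewrites all six terms as `κ(x, ·)` of double brackets of `y`,
`z`, `w`. The first three and the last three each cancel by the Jacobi identity. -/
theorem dReal3_cartanForm (x y z w : L) : dReal3 (cartanForm L) x y z w = 0 := by
  have h : ∀ p q r t : L, killingForm ℝ L ⁅⁅p, q⁆, r⁆ t = killingForm ℝ L p ⁅q, ⁅r, t⁆⁆ :=
    fun p q r t => by
      rw [LieModule.traceForm_apply_lie_apply, LieModule.traceForm_apply_lie_apply]
  have h' : ∀ p q r t : L, killingForm ℝ L ⁅⁅p, q⁆, r⁆ t = killingForm ℝ L r ⁅t, ⁅p, q⁆⁆ :=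
    fun p q r t => by
      rw [LieModule.traceForm_apply_lie_apply, LieModule.traceForm_comm,
        LieModule.traceForm_apply_lie_apply]
  have hj : ⁅y, ⁅z, w⁆⁆ = ⁅z, ⁅y, w⁆⁆ - ⁅w, ⁅y, z⁆⁆ := by
    rw [leibniz_lie y z w, ← lie_skew w ⁅y, z⁆]
    abel
  simp only [dReal3, cartanForm_apply]
  rw [h x y z w, h x z y w, h x w y z, h' y z x w, h' y w x z, h' z w x y, hj]
  simp only [map_sub]
  ring

theorem pull3_cartanForm (f : L ≃ₗ⁅ℝ⁆ L) : pull3 f.toLieHom (cartanForm L) = cartanForm L := by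
  ext w
  change killingForm ℝ L ⁅f (w 0), f (w 1)⁆ (f (w 2)) = killingForm ℝ L ⁅w 0, w 1⁆ (w 2)
  rw [← LieEquiv.map_lie, LieAlgebra.killingForm_of_equiv_apply]

/-- The product `⟨a ∧ t⟩` as an alternating map. -/
def wedge21Form {M : Type*} [AddCommGroup M] [Module ℝ M] (B : LinearMap.BilinForm ℝ M)
    (a : twoCochain ℝ L M) (t : L →ₗ[ℝ] M) : L [⋀^Fin 3]→ₗ[ℝ] ℝ where
  toFun w := wedge21 B a t (w 0) (w 1) (w 2)
  map_update_add' := by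
    intro inst w i x y
    obtain rfl : inst = instDecidableEqFin 3 := Subsingleton.elim _ _
    fin_cases i <;> simp [Function.update, wedge21] <;> ring
  map_update_smul' := by
    intro inst w i r x
    obtain rfl : inst = instDecidableEqFin 3 := Subsingleton.elim _ _
    fin_cases i <;> simp [Function.update, wedge21] <;> ring
  map_eq_zero_of_eq' := by
    intro w i j h hij
    have h1 := twoCochain_skew a (w 1) (w 2)
    have h2 := twoCochain_skew a (w 0) (w 1)
    fin_cases i <;> fin_cases j <;> simp_all [wedge21]
    all_goals rw [← h2]; simp

namespace CyclicBasis

variable (s : CyclicBasis L)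

theorem killingForm_e2 : killingForm ℝ L (s.e 2) (s.e 2) = -(2 * (s.a * s.b)) := by
  rw [LieModule.traceForm_apply_apply, LinearMap.trace_eq_matrix_trace ℝ s.e, Matrix.trace_fin_three]
  simp only [LinearMap.toMatrix_apply, LinearMap.comp_apply, LieModule.toEnd_apply_apply,
    s.lie20, s.lie21, lie_self, lie_smul, lie_neg]
  simp
  ring

theorem cartanForm_basis : cartanForm L s.e = -(2 * (s.a * s.b * s.c)) := by
  change killingForm ℝ L ⁅s.e 0, s.e 1⁆ (s.e 2) = _
  rw [s.lie01, map_smul, LinearMap.smul_apply, s.killingForm_e2, smul_eq_mul]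
  ring

/-- Top-degree forms on a three-dimensional space are proportional, and the Cartan form has the
nonzero value `-2abc` on the basis. Closedness and invariance of arbitrary 3-forms are thereby
reduced to those of the Cartan form. -/
theorem exists_eq_smul_cartanForm (s : CyclicBasis L) (g : L [⋀^Fin 3]→ₗ[ℝ] ℝ) :
    ∃ r : ℝ, g = r • cartanForm L := by
  have h : cartanForm L s.e ≠ 0 := by
    rw [s.cartanForm_basis]
    simp [s.ha, s.hb, s.hc]
  refine ⟨g s.e / cartanForm L s.e, ?_⟩
  rw [(cartanForm L).eq_smul_basis_det s.e, AlternatingMap.smul_apply, Basis.det_self, smul_smul,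
    smul_eq_mul, mul_one, div_mul_cancel₀ _ h]
  exact g.eq_smul_basis_det s.e

theorem threeForm_ext {f g : L [⋀^Fin 3]→ₗ[ℝ] ℝ}
    (h : f ![s.e 0, s.e 1, s.e 2] = g ![s.e 0, s.e 1, s.e 2]) : f = g := by
  have he : (s.e : Fin 3 → L) = ![s.e 0, s.e 1, s.e 2] := by
    ext i; fin_cases i <;> rfl
  rw [f.eq_smul_basis_det s.e, g.eq_smul_basis_det s.e, he, h]

theorem dReal3_eq_zero (s : CyclicBasis L) (g : L [⋀^Fin 3]→ₗ[ℝ] ℝ) (x y z w : L) :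
    dReal3 g x y z w = 0 := by
  obtain ⟨r, rfl⟩ := s.exists_eq_smul_cartanForm g
  have h := dReal3_cartanForm x y z w
  simp only [dReal3, AlternatingMap.smul_apply, smul_eq_mul] at h ⊢
  linear_combination r * h

theorem pull3_eq (s : CyclicBasis L) (f : L ≃ₗ⁅ℝ⁆ L) (g : L [⋀^Fin 3]→ₗ[ℝ] ℝ) :
    pull3 f.toLieHom g = g := by
  obtain ⟨r, rfl⟩ := s.exists_eq_smul_cartanForm g
  conv_rhs => rw [← pull3_cartanForm f]
  rfl

/-- Each term pairs a basis vector with a multiple of itself. Hence exact real 3-forms are zero,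
which makes `γ` an invariant of its class. -/
theorem dReal2_basis (σ : twoCochain ℝ L ℝ) : dReal2 σ (s.e 0) (s.e 1) (s.e 2) = 0 := by
  simp [dReal2, s.lie01, s.lie02, s.lie12]

end CyclicBasis

/-! ### The condition `(T₁)` and the bijection with 3-forms. -/

namespace Triple

variable (T : Triple.{u, v})

/-- The involution of a triple as a Lie algebra automorphism. -/
def thLEquiv : T.L ≃ₗ⁅ℝ⁆ T.L :=
  { T.thL with
    invFun := T.thL
    left_inv := T.thL_invol
    right_inv := T.thL_invol }

theorem mem_Lminus {x : T.L} : x ∈ T.Lminus ↔ T.thL x = -x := by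
  rw [Lminus, LinearMap.mem_ker]
  exact add_eq_zero_iff_eq_neg

theorem mem_Lplus {x : T.L} : x ∈ T.Lplus ↔ T.thL x = x := by
  rw [Lplus, LinearMap.mem_ker]
  exact sub_eq_zero

theorem condT1_of_cyclicBasis (s : CyclicBasis T.L) (hT : T.thL ≠ LieHom.id) : T.CondT1 := by
  set P := Submodule.span ℝ {w | ∃ x ∈ T.Lminus, ∃ y ∈ T.Lminus, w = ⁅x, y⁆} with hP
  have hPL : P ≤ T.Lplus := by
    rw [hP, Submodule.span_le]
    rintro _ ⟨x, hx, y, hy, rfl⟩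
    rw [mem_Lminus] at hx hy
    rw [SetLike.mem_coe, mem_Lplus, LieHom.map_lie, hx, hy, neg_lie, lie_neg, neg_neg]
  have hpm : ∀ u ∈ T.Lplus, ∀ q ∈ T.Lminus, ⁅u, q⁆ ∈ T.Lminus := by
    intro u hu q hq
    rw [mem_Lplus] at hu
    rw [mem_Lminus] at hq ⊢
    rw [LieHom.map_lie, hu, hq, lie_neg]
  have hmp : ∀ q ∈ T.Lminus, ∀ u ∈ T.Lplus, ⁅q, u⁆ ∈ T.Lminus := by
    intro q hq u hu
    rw [← lie_skew]
    exact T.Lminus.neg_mem (hpm u hu q hq)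
  have hmm : ∀ x ∈ T.Lminus, ∀ y ∈ T.Lminus, ⁅x, y⁆ ∈ P := fun x hx y hy =>
    Submodule.subset_span ⟨x, hx, y, hy, rfl⟩
  have hpP : ∀ u ∈ T.Lplus, ∀ p ∈ P, ⁅u, p⁆ ∈ P := by
    intro u hu p hp
    induction hp using Submodule.span_induction with
    | mem p hp =>
      obtain ⟨x, hx, y, hy, rfl⟩ := hp
      rw [leibniz_lie]
      exact P.add_mem (hmm _ (hpm u hu x hx) _ hy) (hmm _ hx _ (hpm u hu y hy))
    | zero => simp
    | add p q _ _ hp hq => rw [lie_add]; exact P.add_mem hp hq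
    | smul r p _ hp => rw [lie_smul]; exact P.smul_mem _ hp
  have hdec : ∀ x : T.L, ∃ u ∈ T.Lplus, ∃ w ∈ T.Lminus, x = u + w := by
    intro x
    refine ⟨(1 / 2 : ℝ) • (x + T.thL x), ?_, (1 / 2 : ℝ) • (x - T.thL x), ?_, by module⟩
    · rw [mem_Lplus, map_smul, map_add, T.thL_invol, add_comm]
    · rw [mem_Lminus, map_smul, map_sub, T.thL_invol]; module
  -- `[𝔩₋, 𝔩₋] + 𝔩₋` is an ideal containing all `x - θ x`, so it is everything when `θ` is not the
  -- identity. Its `θ`-fixed part is `[𝔩₋, 𝔩₋]`.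
  let I : LieIdeal ℝ T.L :=
    { P ⊔ T.Lminus with
      lie_mem := fun {x m} hm => by
        obtain ⟨p, hp, q, hq, rfl⟩ := Submodule.mem_sup.mp hm
        obtain ⟨u, hu, w, hw, rfl⟩ := hdec x
        change ⁅u + w, p + q⁆ ∈ P ⊔ T.Lminus
        have h : ⁅u + w, p + q⁆ = (⁅u, p⁆ + ⁅w, q⁆) + (⁅u, q⁆ + ⁅w, p⁆) := by
          simp only [add_lie, lie_add]; abel
        rw [h]
        exact Submodule.add_mem_sup (P.add_mem (hpP u hu p hp) (hmm w hw q hq))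
          (T.Lminus.add_mem (hpm u hu q hq) (hmp w hw p (hPL hp))) }
  have hI : I ≠ ⊥ := by
    intro hI
    apply hT
    ext x
    have hx : x - T.thL x ∈ I := by
      have : x - T.thL x ∈ T.Lminus := by
        rw [mem_Lminus, map_sub, T.thL_invol, neg_sub]
      exact Submodule.mem_sup_right this
    rw [hI, LieSubmodule.mem_bot, sub_eq_zero] at hx
    exact hx.symm
  have htop := s.ideal_eq_top hI
  refine le_antisymm hPL fun x hx => ?_
  have hxI : x ∈ I := by rw [htop]; exact LieSubmodule.mem_top x
  obtain ⟨p, hp, q, hq, rfl⟩ := Submodule.mem_sup.mp hxI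
  have h1 : q ∈ T.Lplus := by
    have := T.Lplus.sub_mem hx (hPL hp)
    rwa [add_sub_cancel_left] at this
  rw [mem_Lminus] at hq
  rw [mem_Lplus, hq] at h1
  have h2 : (2 : ℝ) • q = 0 := by
    rw [two_smul]
    nth_rewrite 1 [← h1]
    exact neg_add_cancel q
  rw [(smul_eq_zero.mp h2).resolve_left two_ne_zero, add_zero]
  exact hp

theorem threeForm_mem_cocycles (s : CyclicBasis T.L) (g : T.C3) : ((0, g) : T.C2A × T.C3) ∈ T.cocycles := by
  refine ⟨?_, s.pull3_eq T.thLEquiv g, map_zero _, fun x y z w => ?_⟩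
  · apply Subtype.ext
    ext x y
    exact map_zero T.thA
  · rw [s.dReal3_eq_zero]
    have h : ∀ x y : T.L, (0 : T.C2A) x y = 0 := fun _ _ => rfl
    simp [wedge22, h]

/-- The class `[0, γ]` of a 3-form. -/
def threeFormClass (s : CyclicBasis T.L) (g : T.C3) : T.HQ := T.cls ⟨(0, g), T.threeForm_mem_cocycles s g⟩

theorem threeFormClass_injective (s : CyclicBasis T.L) : Function.Injective (T.threeFormClass s) := by
  intro g g' h
  obtain ⟨t, σ, -, -, h1, h2⟩ := Quotient.exact h
  refine s.threeForm_ext ?_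
  have h2 := h2 (s.e 0) (s.e 1) (s.e 2)
  simp only [zero_add] at h1
  rw [← h1, s.dReal2_basis] at h2
  have hz : ∀ x y : T.L, (0 + (1 / 2 : ℝ) • (0 : T.C2A)) x y = 0 := fun x y => by
    rw [smul_zero, add_zero]; rfl
  simp only [wedge21, hz] at h2
  simpa using h2.symm

theorem d₁₂_conj (t : T.L →ₗ[ℝ] T.A) :
    d₁₂ ℝ T.L T.A (T.thA ∘ₗ t ∘ₗ (T.thL : T.L →ₗ[ℝ] T.L))
      = pull2 T.thL T.thA (d₁₂ ℝ T.L T.A t) := by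
  have h : ∀ (x : T.L) (a : T.A), ⁅x, T.thA a⁆ = T.thA ⁅T.thL x, a⁆ := fun x a => (T.compat x a).symm
  apply Subtype.ext
  ext x y
  change ⁅x, T.thA (t (T.thL y))⁆ - ⁅y, T.thA (t (T.thL x))⁆ - T.thA (t (T.thL ⁅x, y⁆))
    = T.thA (⁅T.thL x, t (T.thL y)⁆ - ⁅T.thL y, t (T.thL x)⁆ - t ⁅T.thL x, T.thL y⁆)
  rw [h, h, LieHom.map_lie, map_sub, map_sub]

/-- The differential commutes with `Θ`, so the average of a primitive and its `Θ`-image is again a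
primitive. -/
theorem exists_invariant_primitive (s : CyclicBasis T.L) (hA : IsSemisimpleLie T.L T.A)
    {al : T.C2A} (h : pull2 T.thL T.thA al = al) (hd : d₂₃ ℝ T.L T.A al = 0) :
    ∃ t : T.L →ₗ[ℝ] T.A, (∀ x, T.thA (t (T.thL x)) = t x) ∧ d₁₂ ℝ T.L T.A t = al := by
  obtain ⟨t, rfl⟩ := s.exists_d₁₂_eq hA hd
  refine ⟨(1 / 2 : ℝ) • (t + T.thA ∘ₗ t ∘ₗ (T.thL : T.L →ₗ[ℝ] T.L)), fun x => ?_, ?_⟩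
  · simp only [LinearMap.smul_apply, LinearMap.add_apply, LinearMap.comp_apply, map_smul, map_add,
      LieHom.coe_toLinearMap, T.thL_invol, T.thA_invol]
    rw [add_comm]
  · rw [map_smul, map_add, d₁₂_conj, h]
    module

theorem threeFormClass_surjective (s : CyclicBasis T.L) (hA : IsSemisimpleLie T.L T.A) :
    Function.Surjective (T.threeFormClass s) := by
  intro p
  obtain ⟨⟨⟨al, g⟩, hz⟩, rfl⟩ := Quotient.exists_rep p
  obtain ⟨t, ht, rfl⟩ := T.exists_invariant_primitive s hA hz.1 hz.2.2.1
  -- Translating `(dτ, γ)` by `(-τ, 0)` kills the first component; this witness is the resulting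
  -- second component.
  refine ⟨g + wedge21Form T.form (d₁₂ ℝ T.L T.A t + (1 / 2 : ℝ) • d₁₂ ℝ T.L T.A (-t)) (-t), ?_⟩
  refine (Quotient.sound (s := T.cohomSetoid) ?_).symm
  refine ⟨-t, 0, fun x => by simp [ht], ?_, ?_, fun x y w => ?_⟩
  · apply Subtype.ext
    ext x y
    rfl
  · rw [map_neg, add_neg_cancel]
  · have h : dReal2 (0 : T.C2) x y w = 0 := by
      have h0 : ∀ x y : T.L, (0 : T.C2) x y = 0 := fun _ _ => rfl
      simp [dReal2, h0]
    rw [h, add_zero]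
    rfl

end Triple

/-! ### The ideals `R_k`, and the case without invariants. -/

theorem isSemisimpleLie_of_eq_bot_or_eq_top {L M : Type*} [LieRing L] [LieAlgebra ℝ L]
    [AddCommGroup M] [Module ℝ M] [LieRingModule L M] [LieModule ℝ L M]
    (h : ∀ N : LieSubmodule ℝ L M, N = ⊥ ∨ N = ⊤) : IsSemisimpleLie L M := by
  refine ⟨fun N => ?_⟩
  rcases h N with rfl | rfl
  · exact ⟨⊤, isCompl_bot_top⟩
  · exact ⟨⊥, isCompl_top_bot⟩

namespace CyclicBasis

variable {L : Type*} [LieRing L] [LieAlgebra ℝ L]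

theorem radSeries_succ_eq_bot (s : CyclicBasis L) (k : ℕ) : radSeries L (k + 1) = ⊥ := by
  induction k with
  | zero =>
    refine le_bot_iff.mp (sInf_le ⟨bot_le, isSemisimpleLie_of_eq_bot_or_eq_top fun N => ?_⟩)
    -- The preimage of `N` in the algebra is an ideal, so simplicity leaves only the two extreme
    -- cases.
    let J : LieIdeal ℝ L :=
      { carrier := {x | (LieSubmodule.Quotient.mk (⟨x, LieSubmodule.mem_top x⟩ : radSeries L 0) :
          ↥(radSeries L 0) ⧸ LieSubmodule.comap (LieSubmodule.incl (radSeries L 0)) ⊥) ∈ N}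
        add_mem' := fun hx hy => N.add_mem hx hy
        zero_mem' := N.zero_mem
        smul_mem' := fun r _ hx => N.smul_mem r hx
        lie_mem := fun {x _} hm => N.lie_mem (x := x) hm }
    by_cases hJ : J = ⊥
    · left
      rw [LieSubmodule.eq_bot_iff]
      intro q hq
      obtain ⟨x, rfl⟩ := LieSubmodule.Quotient.surjective_mk' _ q
      have hx : (x : L) ∈ J := hq
      rw [hJ, LieSubmodule.mem_bot] at hx
      have hx0 : x = 0 := Subtype.ext hx
      rw [hx0, map_zero]
    · right
      have hJ := s.ideal_eq_top hJ
      rw [eq_top_iff]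
      intro q _
      obtain ⟨x, rfl⟩ := LieSubmodule.Quotient.surjective_mk' _ q
      have hx : (x : L) ∈ J := by rw [hJ]; exact LieSubmodule.mem_top _
      exact hx
  | succ k ih =>
    refine le_bot_iff.mp (sInf_le ⟨bot_le, isSemisimpleLie_of_eq_bot_or_eq_top fun N => ?_⟩)
    left
    rw [LieSubmodule.eq_bot_iff]
    intro q _
    obtain ⟨x, rfl⟩ := LieSubmodule.Quotient.surjective_mk' _ q
    have hx : x = 0 := Subtype.ext ((LieSubmodule.eq_bot_iff _).mp ih x x.2)
    rw [hx, map_zero]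

theorem injective_of_ne_zero (s : CyclicBasis L) {L' : Type*} [LieRing L'] [LieAlgebra ℝ L']
    {f : L →ₗ⁅ℝ⁆ L'} (hf : f ≠ 0) : Function.Injective f := by
  rw [← LieHom.ker_eq_bot]
  by_contra h
  apply hf
  ext x
  have hx : x ∈ f.ker := by
    rw [s.ideal_eq_top h]
    exact LieSubmodule.mem_top x
  rwa [LieHom.mem_ker] at hx

end CyclicBasis

namespace Triple

variable {T : Triple.{u, v}}

theorem mem_inv {a : T.A} : a ∈ T.inv ↔ ∀ x : T.L, ⁅x, a⁆ = 0 :=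
  LieModule.mem_maxTrivSubmodule _ _ _ _

theorem isNondegSub_of_forall {W : Submodule ℝ T.A}
    (h : ∀ a ∈ W, (∀ b ∈ W, T.form a b = 0) → a = 0) : T.IsNondegSub W := by
  refine ⟨fun a ha => Subtype.ext (h a a.2 fun b hb => ha ⟨b, hb⟩),
    fun a ha => Subtype.ext (h a a.2 fun b hb => ?_)⟩
  rw [T.form_comm]
  exact ha ⟨b, hb⟩

theorem isAdmissibleCocycle_of_inv_eq_bot (s : CyclicBasis T.L) (h : T.inv = ⊥) (g : T.C3) :
    T.IsAdmissibleCocycle (0, g) := by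
  refine ⟨?_, fun x₀ hx₀ _ _ => s.eq_zero_of_central hx₀, ?_, fun k hk => ?_⟩
  · simp only [CondT2, alphaZeroKer, h, bot_inf_eq, inf_bot_eq]
  · refine isNondegSub_of_forall fun a ha _ => ?_
    rw [alphaZeroKer, h, inf_bot_eq] at ha
    exact (Submodule.mem_bot ℝ).mp ha
  · obtain ⟨k, rfl⟩ := Nat.exists_eq_add_of_le' hk
    -- `R_k = 0` leaves no nonzero ideal to test in `(A_k)`. For `(B_k)`, since `α = 0`, the map `Φ
    -- = 0` works for all of `𝔞`, which is therefore the greatest submodule.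
    refine ⟨fun I hI _ => ?_, ⊤, ⟨⟨0, fun x y b _ => ?_⟩, fun N _ => le_top⟩, ?_⟩
    · rw [s.radSeries_succ_eq_bot, inf_bot_eq] at hI
      exact le_bot_iff.mp hI
    · have h0 : (0 : T.C2A) x y = 0 := rfl
      simp [h0]
    · exact isNondegSub_of_forall fun a _ ha => T.form_nondeg.1 a fun b => ha b trivial

/-- If the Lie algebra part were zero, equivariance would put the image of the module part into the
invariants, so the whole morphism would vanish. -/
theorem Hom.S_ne_zero {T₁ : Triple.{u, v}} (h : T.inv = ⊥) (f : T.Hom T₁)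
    (hf : ¬ (f.S = 0 ∧ f.U = 0)) : f.S ≠ 0 := by
  intro hS
  refine hf ⟨hS, LinearMap.ext fun a => ?_⟩
  have ha : f.U a ∈ T.inv := by
    rw [mem_inv]
    intro x
    rw [← f.equivariant, hS, LieHom.zero_apply, zero_lie, map_zero]
  rw [h] at ha
  exact (Submodule.mem_bot ℝ).mp ha

theorem not_isNontrivialDecomp (s : CyclicBasis T.L) (h : T.inv = ⊥) {T₁ T₂ : Triple.{u, v}}
    (f₁ : T.Hom T₁) (f₂ : T.Hom T₂) : ¬ IsNontrivialDecomp f₁ f₂ := by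
  rintro ⟨h₁, h₂, g, hgS, -, hS, -⟩
  have i₁ := s.injective_of_ne_zero (f₁.S_ne_zero h h₁)
  have i₂ := s.injective_of_ne_zero (f₂.S_ne_zero h h₂)
  -- A preimage of `(q₁ e₀, 0)` is killed by the injective `q₂`, hence is zero, although `q₁ e₀ ≠
  -- 0`.
  obtain ⟨y, hy⟩ := hS.2 ((f₁.S (s.e 0), 0) : T₁.L × T₂.L)
  rw [hgS] at hy
  have hy2 : f₂.S y = 0 := congrArg Prod.snd hy
  have hy1 : f₁.S y = f₁.S (s.e 0) := congrArg Prod.fst hy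
  rw [i₂ (hy2.trans f₂.S.map_zero.symm)] at hy1
  exact s.e.ne_zero 0 (i₁ hy1).symm

theorem HQzero_eq_univ (s : CyclicBasis T.L) (hA : IsSemisimpleLie T.L T.A) (h : T.inv = ⊥) :
    T.HQzero = Set.univ := by
  rw [Set.eq_univ_iff_forall]
  intro p
  obtain ⟨g, rfl⟩ := T.threeFormClass_surjective s hA p
  refine ⟨⟨_, rfl, isAdmissibleCocycle_of_inv_eq_bot s h g⟩, ?_⟩
  rintro ⟨T₁, T₂, f₁, f₂, hf, -⟩
  exact not_isNontrivialDecomp s h f₁ f₂ hf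

/-! ### The case of non-zero invariants. -/

theorem form_lie_of_mem_inv {a : T.A} (ha : a ∈ T.inv) (x : T.L) (b : T.A) :
    T.form a ⁅x, b⁆ = 0 := by
  have h := T.form_inv x a b
  rwa [mem_inv.mp ha, map_zero, LinearMap.zero_apply, zero_add] at h

/-- Invariants are orthogonal to every `ρ(L)A`, in particular to Casimir images, and these span a
complement. An invariant orthogonal to all invariants is thus orthogonal to the whole module. -/
theorem isNondegSub_inv (s : CyclicBasis T.L) (hA : IsSemisimpleLie T.L T.A) :
    T.IsNondegSub T.inv := by
  obtain ⟨N, hN, -, hsurj⟩ := s.exists_complement hA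
  refine isNondegSub_of_forall fun a ha hab => T.form_nondeg.1 a fun b => ?_
  have hb : b ∈ LieModule.maxTrivSubmodule ℝ T.L T.A ⊔ N := by
    rw [hN.sup_eq_top]; exact LieSubmodule.mem_top _
  obtain ⟨p, hp, n, hn, rfl⟩ := (LieSubmodule.mem_sup _ _ _).mp hb
  obtain ⟨w, -, rfl⟩ := hsurj n hn
  rw [map_add, hab p hp, s.casimir_apply]
  simp [form_lie_of_mem_inv ha]

variable (T) in
/-- The orthogonal complement of the invariants. -/
def invPerp : LieSubmodule ℝ T.L T.A :=
  { T.form.orthogonal T.inv with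
    lie_mem := fun _ _ ha => form_lie_of_mem_inv ha _ _ }

theorem mem_invPerp {b : T.A} : b ∈ T.invPerp ↔ ∀ a ∈ T.inv, T.form a b = 0 := Iff.rfl

theorem form_add_add {a b a' b' : T.A} (ha : a ∈ T.invPerp) (hb : b ∈ T.inv)
    (ha' : a' ∈ T.invPerp) (hb' : b' ∈ T.inv) :
    T.form (a + b) (a' + b') = T.form a a' + T.form b b' := by
  rw [map_add, map_add, LinearMap.add_apply, LinearMap.add_apply,
    T.form_comm a b', mem_invPerp.mp ha b' hb', mem_invPerp.mp ha' b hb]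
  ring

theorem isCompl_inv_invPerp (s : CyclicBasis T.L) (hA : IsSemisimpleLie T.L T.A) :
    IsCompl T.inv T.invPerp.toSubmodule :=
  LinearMap.BilinForm.isCompl_orthogonal_of_restrict_nondegenerate T.form_symm.isRefl
    (isNondegSub_inv s hA)

theorem isNondegSub_invPerp (s : CyclicBasis T.L) (hA : IsSemisimpleLie T.L T.A) :
    T.IsNondegSub T.invPerp.toSubmodule := by
  refine isNondegSub_of_forall fun a ha hab => T.form_nondeg.1 a fun b => ?_
  obtain ⟨p, hp, n, hn, rfl⟩ := Submodule.mem_sup.mp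
    ((isCompl_inv_invPerp s hA).sup_eq_top ▸ Submodule.mem_top : b ∈ T.inv ⊔ T.invPerp.toSubmodule)
  rw [map_add, hab n hn, T.form_comm a p, mem_invPerp.mp ha p hp, add_zero]

theorem thA_mem_inv {a : T.A} (ha : a ∈ T.inv) : T.thA a ∈ T.inv := by
  rw [mem_inv] at ha ⊢
  intro x
  rw [← T.compat, ha, map_zero]

theorem thA_mem_invPerp {b : T.A} (hb : b ∈ T.invPerp) : T.thA b ∈ T.invPerp := by
  rw [mem_invPerp] at hb ⊢
  intro a ha
  rw [← T.thA_isom, T.thA_invol]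
  exact hb _ (thA_mem_inv ha)

variable (T) in
/-- The triple obtained by restricting the module to a non-degenerate involution-stable
submodule. -/
def restrict (N : LieSubmodule ℝ T.L T.A) (hN : T.IsNondegSub N.toSubmodule)
    (hθ : ∀ a ∈ N, T.thA a ∈ N) : Triple.{u, v} where
  L := T.L
  A := N
  thL := T.thL
  thL_invol := T.thL_invol
  form := T.form.restrict N.toSubmodule
  form_symm := ⟨fun a b => T.form_comm a b⟩
  form_nondeg := hN
  form_inv := fun x a b => T.form_inv x a b
  thA := T.thA.restrict hθ
  thA_invol := fun a => Subtype.ext (T.thA_invol a)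
  thA_isom := fun a b => T.thA_isom a b
  compat := fun x a => Subtype.ext (T.compat x a)

/-- The zero Lie ring structure on the one-point type. -/
abbrev punitLieRing : LieRing PUnit.{u + 1} where
  bracket _ _ := 0
  add_lie _ _ _ := rfl
  lie_add _ _ _ := rfl
  lie_self _ := rfl
  leibniz_lie _ _ _ := rfl

variable (T) in
/-- The triple with zero Lie algebra on a non-degenerate involution-stable subspace. -/
def overZero (W : Submodule ℝ T.A) (hW : T.IsNondegSub W) (hθ : ∀ a ∈ W, T.thA a ∈ W) :
    Triple.{u, v} :=
  letI : LieRing PUnit.{u + 1} := punitLieRing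
  letI : LieAlgebra ℝ PUnit.{u + 1} := { lie_smul := fun _ _ _ => rfl }
  letI : LieRingModule PUnit.{u + 1} W :=
    { bracket := fun _ _ => 0
      add_lie := fun _ _ _ => (add_zero 0).symm
      lie_add := fun _ _ _ => (add_zero 0).symm
      leibniz_lie := fun _ _ _ => (add_zero 0).symm }
  { L := PUnit.{u + 1}
    A := W
    lieModule :=
      { smul_lie := fun r _ _ => (smul_zero r).symm
        lie_smul := fun r _ _ => (smul_zero r).symm }
    thL := LieHom.id
    thL_invol := fun _ => rfl
    form := T.form.restrict W
    form_symm := ⟨fun a b => T.form_comm a b⟩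
    form_nondeg := hW
    form_inv := fun _ a b => by
      change (T.form.restrict W) 0 b + (T.form.restrict W) a 0 = 0
      rw [map_zero, map_zero, LinearMap.zero_apply, add_zero]
    thA := T.thA.restrict hθ
    thA_invol := fun a => Subtype.ext (T.thA_invol a)
    thA_isom := fun a b => T.thA_isom a b
    compat := fun _ _ => map_zero (T.thA.restrict hθ) }

theorem zero_pair_mem_cocycles : ((0, 0) : T.C2A × T.C3) ∈ T.cocycles := by
  refine ⟨?_, ?_, map_zero _, fun x y z w => ?_⟩
  · apply Subtype.ext
    ext x y
    exact map_zero T.thA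
  · rfl
  · have h : ∀ x y : T.L, (0 : T.C2A) x y = 0 := fun _ _ => rfl
    simp [wedge22, dReal3, h]

/-- The projection of a triple to its restriction. -/
def toRestrict (N : LieSubmodule ℝ T.L T.A) (hN : T.IsNondegSub N.toSubmodule)
    (hθ : ∀ a ∈ N, T.thA a ∈ N) : T.Hom (T.restrict N hN hθ) where
  S := LieHom.id
  U := N.toSubmodule.subtype
  isometry := fun _ _ => rfl
  injective := Subtype.val_injective
  equivariant := fun _ _ => rfl
  comm_thL := fun _ => rfl
  comm_thA := fun _ => rfl

/-- The projection of a triple to a subspace of invariants over the zero Lie algebra. -/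
def toOverZero (W : Submodule ℝ T.A) (hW : T.IsNondegSub W) (hθ : ∀ a ∈ W, T.thA a ∈ W)
    (hinv : W ≤ T.inv) : T.Hom (T.overZero W hW hθ) where
  S := 0
  U := W.subtype
  isometry := fun _ _ => rfl
  injective := Subtype.val_injective
  equivariant := fun x a => (mem_inv.mp (hinv a.2) x).symm
  comm_thL := fun _ => rfl
  comm_thA := fun _ => rfl

theorem isNontrivialDecomp_inv (s : CyclicBasis T.L) (hA : IsSemisimpleLie T.L T.A)
    (h : T.inv ≠ ⊥) :
    IsNontrivialDecomp
      (toRestrict T.invPerp (isNondegSub_invPerp s hA) fun _ => thA_mem_invPerp)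
      (toOverZero T.inv (isNondegSub_inv s hA) (fun _ => thA_mem_inv) le_rfl) := by
  have hc := isCompl_inv_invPerp s hA
  refine ⟨fun h0 => s.e.ne_zero 0 (congrArg (fun f => f (s.e 0)) h0.1), fun h0 => ?_, ?_⟩
  · obtain ⟨a, ha, ha0⟩ := Submodule.exists_mem_ne_zero_of_ne_bot h
    exact ha0 (congrArg (fun f => f ⟨a, ha⟩) h0.2)
  · let U := Submodule.prodEquivOfIsCompl _ _ hc.symm
    refine ⟨{ S := LieHom.prod LieHom.id 0
              U := U.toLinearMap
              isometry := ?_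
              injective := U.injective
              equivariant := ?_
              comm_thL := fun _ => rfl
              comm_thA := ?_ }, fun _ => rfl, fun _ _ => rfl, ⟨?_, ?_⟩, U.bijective⟩
    · rintro ⟨a, b⟩ ⟨a', b'⟩
      exact form_add_add a.2 b.2 a'.2 b'.2
    · rintro x ⟨a, b⟩
      change ⁅x, a.1⁆ + 0 = ⁅x, a.1 + b.1⁆
      rw [lie_add, mem_inv.mp b.2 x]
    · rintro ⟨a, b⟩
      exact (map_add T.thA a.1 b.1).symm
    · intro x y hxy
      exact congrArg Prod.fst hxy
    · rintro ⟨x, y⟩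
      exact ⟨x, rfl⟩

/-- A representative `(0, γ)` does not involve the module, so it is the pull-back of `(0, γ)` on the
triple with module `(𝔞^𝔩)^⊥` plus the zero cocycle over the zero algebra. -/
theorem isDecomposable_of_inv_ne_bot (s : CyclicBasis T.L) (hA : IsSemisimpleLie T.L T.A)
    (h : T.inv ≠ ⊥) (p : T.HQ) : T.IsDecomposable p := by
  obtain ⟨g, rfl⟩ := T.threeFormClass_surjective s hA p
  refine ⟨_, _, _, _, isNontrivialDecomp_inv s hA h, ⟨(0, g), threeForm_mem_cocycles (T.restrict _ _ _) s g⟩,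
    ⟨(0, 0), zero_pair_mem_cocycles⟩, ⟨(0, g), T.threeForm_mem_cocycles s g⟩, ?_, ?_, rfl⟩
  · apply Subtype.ext
    ext x y
    exact (add_zero (0 : T.A)).symm
  · ext w
    exact (add_zero (g w)).symm

end Triple

end QuadCoh

theorem lemma6p2 (T : QuadCoh.Triple.{u, v}) (hL : QuadCoh.IsSu2OrSl2 T.L)
    (hA : QuadCoh.IsSemisimpleLie T.L T.A) :
    (T.thL ≠ LieHom.id → T.CondT1) ∧
    (∃ h : ∀ g : T.C3, ((0, g) : T.C2A × T.C3) ∈ T.cocycles,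
      Function.Bijective (fun g : T.C3 => T.cls ⟨(0, g), h g⟩)) ∧
    (T.inv = ⊥ → T.HQzero = Set.univ) ∧
    (T.inv ≠ ⊥ → T.HQzero = ∅) := by
  obtain ⟨s⟩ := hL.nonempty_cyclicBasis
  refine ⟨T.condT1_of_cyclicBasis s, ⟨T.threeForm_mem_cocycles s, T.threeFormClass_injective s,
    T.threeFormClass_surjective s hA⟩, QuadCoh.Triple.HQzero_eq_univ s hA, fun h => ?_⟩
  rw [Set.eq_empty_iff_forall_notMem]
  exact fun p hp => hp.2 (QuadCoh.Triple.isDecomposable_of_inv_ne_bot s hA h p)
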